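/- Let $q$ be a power of a prime $p$, let $n\ge 2$ and $d\ge 2$, and let $X=\{F=0\}\subset\mathbb{P}^n$ be a smooth hypersurface defined by a homogeneous polynomial $F\in\mathbb{F}_q[x_0,\dots,x_n]$ of degree $d$. Assume that $X$ is Frobenius nonclassical, that is, for every point $P=[P_0:\dots:P_n]\in X(\overline{\mathbb{F}_q})$ the point $[P_0^q:\dots:P_n^q]$ lies in the tangent hyperplane $\{\sum_{i=0}^n x_i\frac{\partial F}{\partial x_i}(P)=0\}$. Put $$F_{1,0}:=\sum_{i=0}^n x_i^q\,\frac{\partial F}{\partial x_i}.$$ Then $d\le q+2$, and the following hold. (1) $d=q+1$ and $n$ is odd if and only if there exists a nondegenerate skew-symmetric matrix $(A_{ij})_{0\le i,j\le n}$ with entries in $\mathbb{F}_q$ and zero diagonal such that $$F=\sum_{i,j=0}^n x_i^qA_{ij}x_j.$$ (2) $d=q+1$ and $n$ is even if and only if $p=2$ and, after an invertible $\mathbb{F}_q$-linear change of the coordinates $x_0,\dots,x_n$, $$F_{1,0}=x_0^{q-1}F\qquad\text{and}\qquad F=x_0G+\sum_{i,j=1}^n x_i^qB_{ij}x_j,$$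 where $G\in\mathbb{F}_q[x_0,\dots,x_n]$ satisfies $\frac{\partial G}{\partial x_0}=0$ and $(B_{ij})_{1\le i,j\le n}$ is a nondegenerate skew-symmetric matrix with entries in $\mathbb{F}_q$ and zero diagonal. (3) $d=q+2$ if and only if $p=n=2$ and, after multiplying $F$ by a nonzero constant of $\mathbb{F}_q$, $$F=x_0x_1x_2\,(x_0^{q-1}+x_1^{q-1}+x_2^{q-1})+G(x_0^2,x_1^2,x_2^2)$$ for some polynomial $G$ over $\mathbb{F}_q$. Furthermore, $F_{1,0}$ is the zero polynomial if and only if $d=q+1$ and $n$ is odd, or $d=q+2$; that is, if and only if condition (1) or condition (3) occurs. -/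

import Mathlib

open MvPolynomial

namespace FrobeniusNonclassical

/-- The polynomial `F_{1,0} = ∑ i, x_i ^ q * ∂F/∂x_i`, where `q` is the number of elements of the
finite base field `K`. -/
noncomputable def F10 {K : Type*} [Field K] [Fintype K] {n : ℕ}
    (F : MvPolynomial (Fin (n + 1)) K) : MvPolynomial (Fin (n + 1)) K :=
  ∑ i, X i ^ Fintype.card K * pderiv i F

/-- `P` is a vector of homogeneous coordinates of a geometric point of the projective hypersurface
`{F = 0}` in projective `n`-space. -/
def IsGeomPoint {K : Type*} [Field K] {n : ℕ} (F : MvPolynomial (Fin (n + 1)) K)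
    (P : Fin (n + 1) → AlgebraicClosure K) : Prop :=
  P ≠ 0 ∧ aeval P F = 0

/-- The embedded tangent space at `P` of the hypersurface `{F = 0}`, as a cone in affine
`(n + 1)`-space: the set of `x` with `∑ i, x_i * (∂F/∂x_i)(P) = 0`. -/
def tangentSpace {K : Type*} [Field K] {n : ℕ} (F : MvPolynomial (Fin (n + 1)) K)
    (P : Fin (n + 1) → AlgebraicClosure K) : Set (Fin (n + 1) → AlgebraicClosure K) :=
  {x | ∑ i, x i * aeval P (pderiv i F) = 0}

/-- The projective hypersurface `{F = 0}` (with `F` homogeneous) is smooth: at each of its geometric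
points some partial derivative of `F` does not vanish. -/
def IsSmooth {K : Type*} [Field K] {n : ℕ} (F : MvPolynomial (Fin (n + 1)) K) : Prop :=
  ∀ P : Fin (n + 1) → AlgebraicClosure K, IsGeomPoint F P → ∃ i, aeval P (pderiv i F) ≠ 0

/-- The projective hypersurface `{F = 0}` over the finite field `K` with `q` elements is Frobenius
nonclassical: the `q`-th Frobenius morphism `[x_0 : ... : x_n] ↦ [x_0 ^ q : ... : x_n ^ q]` maps
each of its geometric points into the embedded tangent space at that point. -/
def IsFrobeniusNonclassical {K : Type*} [Field K] [Fintype K] {n : ℕ}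
    (F : MvPolynomial (Fin (n + 1)) K) : Prop :=
  ∀ P : Fin (n + 1) → AlgebraicClosure K, IsGeomPoint F P →
    (fun i => P i ^ Fintype.card K) ∈ tangentSpace F P

/-- A nondegenerate skew-symmetric matrix with zero diagonal. -/
def IsNondegSkew {K : Type*} [Field K] {m : ℕ} (A : Matrix (Fin m) (Fin m) K) : Prop :=
  A.transpose = -A ∧ (∀ i, A i i = 0) ∧ A.det ≠ 0

/-- The linear change of coordinates `x_i ↦ ∑ j, g_ij * x_j` applied to the polynomial `F`. -/
noncomputable def linearSubst {K : Type*} [Field K] {n : ℕ}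
    (g : Matrix.GeneralLinearGroup (Fin (n + 1)) K)
    (F : MvPolynomial (Fin (n + 1)) K) : MvPolynomial (Fin (n + 1)) K :=
  aeval (fun i => ∑ j, C (g.val i j) * (X j : MvPolynomial (Fin (n + 1)) K)) F

/-- `F = ∑_{i,j} x_i ^ q * A_ij * x_j` for a nondegenerate skew-symmetric matrix `A` over `K` with
zero diagonal. -/
def HasSkewForm {K : Type*} [Field K] [Fintype K] {n : ℕ}
    (F : MvPolynomial (Fin (n + 1)) K) : Prop :=
  ∃ A : Matrix (Fin (n + 1)) (Fin (n + 1)) K, IsNondegSkew A ∧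
    F = ∑ i, ∑ j, X i ^ Fintype.card K * C (A i j) * X j

/-- `F_{1,0} = x_0 ^ (q - 1) * F` and `F = x_0 * G + ∑_{1 ≤ i, j ≤ n} x_i ^ q * B_ij * x_j`, where
`∂G/∂x_0 = 0` and `B` is a nondegenerate skew-symmetric `n × n` matrix over `K` with zero diagonal.
The index `i : Fin n` of `B` stands for the variable `x_{i + 1}`. -/
def HasPartialSkewForm {K : Type*} [Field K] [Fintype K] {n : ℕ}
    (F : MvPolynomial (Fin (n + 1)) K) : Prop :=
  F10 F = X 0 ^ (Fintype.card K - 1) * F ∧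
  ∃ (G : MvPolynomial (Fin (n + 1)) K) (B : Matrix (Fin n) (Fin n) K),
    pderiv 0 G = 0 ∧ IsNondegSkew B ∧
    F = X 0 * G + ∑ i, ∑ j, X i.succ ^ Fintype.card K * C (B i j) * X j.succ

/-- For a polynomial in `x_0, x_1, x_2`:
`F = x_0 x_1 x_2 (x_0 ^ (q-1) + x_1 ^ (q-1) + x_2 ^ (q-1)) + G (x_0 ^ 2, x_1 ^ 2, x_2 ^ 2)`
for some polynomial `G`. -/
def HasTernaryForm {K : Type*} [Field K] [Fintype K]
    (F : MvPolynomial (Fin 3) K) : Prop :=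
  ∃ G : MvPolynomial (Fin 3) K,
    F = X 0 * X 1 * X 2 *
        (X 0 ^ (Fintype.card K - 1) + X 1 ^ (Fintype.card K - 1) + X 2 ^ (Fintype.card K - 1))
      + aeval (fun i => (X i : MvPolynomial (Fin 3) K) ^ 2) G

end FrobeniusNonclassical

namespace FrobeniusNonclassical

/-! A smooth F is squarefree, so by the Nullstellensatz F divides F_{1,0}, say F_{1,0} = H F with
deg H < q. This is a relation of low degree among the partial derivatives F_i. The classification
rests on a rigidity statement, `NoCommonZero.isKoszulExact`: n + 1 forms of positive degree in n + 1
variables vanishing together only at the origin have only Koszul syzygies.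

If p does not divide d, Euler's formula shows that the F_i have no common zero and turns the
relation into the syzygy (x_i^q - t x_i) with t = H/d. Koszul syzygies start in degree d - 1, so d ≤
q + 1, and for d = q + 1 a constant alternating matrix A satisfies x_i^q - t x_i = ∑ A_ij F_j. A
vector v in the kernel of A gives ∑ v_i x_i^q = t ∑ v_i x_i, so any two are proportional. Hence A is
invertible for n odd, and inverting it in Euler's formula recovers F. For n even A is singular;
moving v to the first coordinate makes t = x_0^(q-1), and the symmetry of second derivatives forces
p = 2.

If p divides d, Euler's formula is itself a syzygy. Over the closure, choose coordinates ℓ_j such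
that ℓ_0 = 0 is nowhere tangent to X. Then F and the derivatives along ℓ_1, ..., ℓ_n have no common
zero. Eliminating the derivative along ℓ_0 leaves the coefficients ℓ_0 ℓ_j^(q) - ℓ_0^(q) ℓ_j, where
ℓ^(q) is ℓ with each x_i replaced by x_i^q. Degrees give d ≤ q + 2, and equality forces H = 0, n = 2
and derivatives spanned by the x_a x_b^q (`degree_le_of_cast_eq_zero`). Then p = 2, and F is found
by comparing monomials.

When F_{1,0} = 0, lower bounds on d come from K-rational points, where x_i^q = x_i. -/

/-- A matrix is alternating: skew-symmetric with zero diagonal. -/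
def IsAlternating {ι R : Type*} [CommRing R] (A : Matrix ι ι R) : Prop :=
  A.transpose = -A ∧ ∀ i, A i i = 0

/-! ### Alternating matrices -/

section Alternating

variable {ι R : Type*} [CommRing R] {A : Matrix ι ι R}

theorem IsAlternating.apply (hA : IsAlternating A) (i j : ι) : A j i = -A i j := by
  have := congrFun (congrFun hA.1 i) j
  simpa using this

theorem isAlternating_of_apply (h : ∀ i j, A j i = -A i j) (h0 : ∀ i, A i i = 0) :
    IsAlternating A :=
  ⟨by ext i j; simpa using h i j, h0⟩

variable [Fintype ι]

open Matrix in
theorem IsAlternating.dotProduct_mulVec_self (hA : IsAlternating A) (v : ι → R) :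
    v ⬝ᵥ A *ᵥ v = 0 := by
  classical
  have : v ⬝ᵥ A *ᵥ v = ∑ x : ι × ι, v x.1 * (A x.1 x.2 * v x.2) := by
    simp [dotProduct, mulVec, Fintype.sum_prod_type, Finset.mul_sum]
  rw [this]
  refine Finset.sum_involution (fun x _ => x.swap) ?_ ?_ ?_ ?_
  · rintro ⟨i, j⟩ -
    simp only [Prod.fst_swap, Prod.snd_swap]
    rw [hA.apply i j]; ring
  · rintro ⟨i, j⟩ - h h'
    simp only [Prod.swap_prod_mk, Prod.mk.injEq] at h'
    obtain ⟨rfl, -⟩ := h'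
    simp [hA.2] at h
  · simp
  · simp

open Matrix in
theorem IsAlternating.conj (hA : IsAlternating A) (Q : Matrix ι ι R) :
    IsAlternating (Qᵀ * A * Q) := by
  refine ⟨?_, fun i => ?_⟩
  · rw [transpose_mul, transpose_mul, hA.1, transpose_transpose]
    simp [Matrix.mul_assoc]
  · have := hA.dotProduct_mulVec_self (fun j => Q j i)
    rw [← this, Matrix.mul_assoc]
    rfl

end Alternating

/-- Every syzygy `h` of the family `g` is a combination of the Koszul syzygies. -/
def IsKoszulExact {ι R : Type*} [Fintype ι] [CommRing R] (g : ι → R) : Prop :=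
  ∀ h : ι → R, ∑ i, h i * g i = 0 →
    ∃ A : Matrix ι ι R, IsAlternating A ∧ ∀ i, h i = ∑ j, A i j * g j

/-! ### Operations on Koszul exact families -/

section Koszul

variable {ι R : Type*} [CommRing R]

open Matrix in
theorem IsKoszulExact.mulVec [Fintype ι] [DecidableEq ι] {g : ι → R} (hg : IsKoszulExact g)
    (P Q : Matrix ι ι R) (hPQ : P * Q = 1) : IsKoszulExact (P *ᵥ g) := by
  intro h hh
  have hQP : Q * P = 1 := mul_eq_one_comm.mp hPQ
  obtain ⟨A, hA, hAg⟩ := hg (h ᵥ* P) (by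
    have : h ⬝ᵥ P *ᵥ g = 0 := hh
    rwa [dotProduct_mulVec] at this)
  have hAg' : h ᵥ* P = A *ᵥ g := funext hAg
  refine ⟨Qᵀ * A * Q, hA.conj Q, fun i => ?_⟩
  have : h = (Qᵀ * A * Q) *ᵥ (P *ᵥ g) := by
    rw [mulVec_mulVec, Matrix.mul_assoc, hQP, Matrix.mul_one, ← mulVec_mulVec, ← hAg',
      mulVec_transpose, vecMul_vecMul, hPQ, vecMul_one]
  exact congrFun this i

/-- Extending an alternating matrix expressing the entries of `h` away from the index `i`. -/
theorem exists_alternating_of_sum_erase [DecidableEq ι] (g h : ι → R) (i : ι) (c : ι → R)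
    (s : Finset ι) (hi : i ∉ s) (hc : h i = ∑ j ∈ s, c j * g j)
    (A : Matrix ι ι R) (hA : IsAlternating A)
    (hAg : ∀ j ∈ s, h j + c j * g i = ∑ l ∈ s, A j l * g l) :
    ∃ B : Matrix ι ι R, IsAlternating B ∧
      ∀ j ∈ insert i s, h j = ∑ l ∈ insert i s, B j l * g l := by
  -- The matrix `A` bordered at `i` by the row `c` and the column `-c`.
  refine ⟨fun j l => if j = i then (if l = i then 0 else c l)
    else if l = i then -c j else A j l, ?_, ?_⟩
  · refine isAlternating_of_apply (fun j l => ?_) (fun j => ?_)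
    · by_cases hj : j = i <;> by_cases hl : l = i <;> simp [hj, hl, hA.apply j l]
    · by_cases hj : j = i <;> simp [hj, hA.2]
  · intro j hj
    have key : ∀ a : ι → R, ∀ b : R, ∑ l ∈ s, (if l = i then b else a l) * g l
        = ∑ l ∈ s, a l * g l := fun a b =>
      Finset.sum_congr rfl fun l hl => by rw [if_neg (ne_of_mem_of_not_mem hl hi)]
    rw [Finset.sum_insert hi]
    rcases Finset.mem_insert.mp hj with rfl | hj
    · simp only [if_true, zero_mul, zero_add, key]
      exact hc
    · have hji : j ≠ i := fun h => hi (h ▸ hj)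
      simp only [if_neg hji, if_true, key, ← hAg j hj]
      ring

end Koszul

/-! ### Koszul exactness of the variables -/

section Variables

variable {σ R : Type*} [CommRing R]

/-- Induction on `s`: `h k * X k` lies in the monomial ideal of the other variables, hence so does
`h k`, and substituting this expression leaves a syzygy of the other variables. -/
theorem exists_alternating_of_sum_mul_X [DecidableEq σ] (s : Finset σ) :
    ∀ h : σ → MvPolynomial σ R, ∑ i ∈ s, h i * X i = 0 →
    ∃ A : Matrix σ σ (MvPolynomial σ R), IsAlternating A ∧
      ∀ i ∈ s, h i = ∑ j ∈ s, A i j * X j := by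
  induction s using Finset.induction_on with
  | empty => exact fun h _ => ⟨0, ⟨by simp, by simp⟩, by simp⟩
  | insert k s hk ih =>
    intro h hh
    rw [Finset.sum_insert hk] at hh
    have hmem : h k ∈ Ideal.span (X '' (s : Set σ) : Set (MvPolynomial σ R)) := by
      have h1 : h k * X k ∈ Ideal.span (X '' (s : Set σ) : Set (MvPolynomial σ R)) := by
        rw [eq_neg_of_add_eq_zero_left hh]
        refine neg_mem (sum_mem fun i hi => Ideal.mul_mem_left _ _ (Ideal.subset_span ?_))
        exact ⟨i, hi, rfl⟩
      rw [mem_ideal_span_X_image] at h1 ⊢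
      intro m hm
      obtain ⟨i, hi, hmi⟩ := h1 (m + Finsupp.single k 1) (by
        rw [mem_support_iff, coeff_mul_X]; exact mem_support_iff.mp hm)
      refine ⟨i, hi, fun h0 => hmi ?_⟩
      have : k ≠ i := fun h => hk (h ▸ hi)
      simp [h0, this]
    obtain ⟨c, hc⟩ : ∃ c : σ → MvPolynomial σ R, h k = ∑ j ∈ s, c j * X j := by
      rw [Ideal.span, Submodule.mem_span_image_finset_iff_exists_fun] at hmem
      obtain ⟨c, hc⟩ := hmem
      refine ⟨fun j => if hj : j ∈ s then c ⟨j, hj⟩ else 0, ?_⟩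
      rw [← hc, ← Finset.sum_coe_sort s]
      simp
    obtain ⟨A, hA, hAh⟩ := ih (fun i => h i + c i * X k) (by
      simp only [add_mul, Finset.sum_add_distrib]
      rw [← hh, hc, add_comm, Finset.sum_mul]
      congr 1
      exact Finset.sum_congr rfl fun i _ => by ring)
    exact exists_alternating_of_sum_erase X h k c s hk hc A hA hAh

theorem isKoszulExact_X [Fintype σ] : IsKoszulExact (X : σ → MvPolynomial σ R) := by
  classical
  intro h hh
  obtain ⟨A, hA, h'⟩ := exists_alternating_of_sum_mul_X Finset.univ h hh
  exact ⟨A, hA, fun i => h' i (Finset.mem_univ i)⟩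

end Variables

/-! ### Degree bounds and exchange of members -/

section Truncation

variable {σ R : Type*} [CommRing R]

/-- The part of a polynomial in degrees less than `n`. -/
noncomputable def truncDegree (n : ℕ) : MvPolynomial σ R →+ MvPolynomial σ R where
  toFun f := ∑ i ∈ Finset.range n, homogeneousComponent i f
  map_zero' := by simp
  map_add' := by simp [Finset.sum_add_distrib]

theorem coeff_truncDegree (n : ℕ) (f : MvPolynomial σ R) (m : σ →₀ ℕ) :
    coeff m (truncDegree n f) = if m.degree < n then coeff m f else 0 := by
  classical
  simp [truncDegree, coeff_sum, coeff_homogeneousComponent]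

/-- Degree bounds are carried as fixed-point equations of `truncDegree`. Truncated subtraction is
harmless: the bound 0 means the zero polynomial. -/
theorem truncDegree_mul {g : MvPolynomial σ R} {e : ℕ} (hg : g.IsHomogeneous e) (n : ℕ)
    (f : MvPolynomial σ R) : truncDegree n (f * g) = truncDegree (n - e) f * g := by
  classical
  ext m
  rw [coeff_truncDegree, coeff_mul, coeff_mul]
  have key : ∀ x ∈ Finset.HasAntidiagonal.antidiagonal m, coeff x.1 (truncDegree (n - e) f) * coeff x.2 g =
      if m.degree < n then coeff x.1 f * coeff x.2 g else 0 := by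
    intro x hx
    by_cases h : coeff x.2 g = 0
    · simp [h]
    · have h2 : x.2.degree = e := by
        by_contra hne
        exact h (hg.coeff_eq_zero hne)
      have h3 : m.degree = x.1.degree + e := by
        rw [← Finset.HasAntidiagonal.mem_antidiagonal.mp hx, map_add, h2]
      rw [coeff_truncDegree, h3]
      by_cases h4 : x.1.degree < n - e
      · rw [if_pos h4, if_pos (by omega)]
      · rw [if_neg h4, if_neg (by omega), zero_mul]
  rw [Finset.sum_congr rfl key]
  split_ifs <;> simp

theorem truncDegree_truncDegree (n : ℕ) (f : MvPolynomial σ R) :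
    truncDegree n (truncDegree n f) = truncDegree n f := by
  ext m
  simp only [coeff_truncDegree]
  split_ifs <;> rfl

theorem truncDegree_of_isHomogeneous {f : MvPolynomial σ R} {e n : ℕ} (hf : f.IsHomogeneous e)
    (hn : e < n) : truncDegree n f = f := by
  ext m
  rw [coeff_truncDegree]
  split_ifs with h
  · rfl
  · exact (hf.coeff_eq_zero (by omega)).symm

theorem truncDegree_zero_left (f : MvPolynomial σ R) : truncDegree 0 f = 0 := by
  ext m
  simp [coeff_truncDegree]

theorem truncDegree_one_left (f : MvPolynomial σ R) : truncDegree 1 f = C (coeff 0 f) := by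
  classical
  ext m
  rw [coeff_truncDegree, coeff_C]
  by_cases hm : m = 0
  · simp [hm]
  · rw [if_neg (Ne.symm hm), if_neg]
    rw [Nat.lt_one_iff, Finsupp.degree_eq_zero_iff]
    exact hm

theorem exists_truncDegree_eq {ι : Type*} [Finite ι] (e : ι → ℕ) (h : ι → MvPolynomial σ R) :
    ∃ N, ∀ i, truncDegree (N - e i) (h i) = h i := by
  classical
  cases nonempty_fintype ι
  refine ⟨∑ i, ((h i).totalDegree + 1 + e i), fun i => ?_⟩
  ext m
  rw [coeff_truncDegree]
  split_ifs with hm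
  · rfl
  · symm
    by_contra hne
    have h1 : m.degree ≤ (h i).totalDegree := le_totalDegree (mem_support_iff.mpr hne)
    have h2 := Finset.single_le_sum (f := fun i => (h i).totalDegree + 1 + e i)
      (fun _ _ => Nat.zero_le _) (Finset.mem_univ i)
    omega

theorem IsAlternating.map {ι R' S : Type*} [CommRing R'] [CommRing S] {A : Matrix ι ι R'}
    (hA : IsAlternating A) (φ : ι → ι → R' →+ S) (hφ : ∀ i j, φ i j = φ j i) :
    IsAlternating (fun i j => φ i j (A i j)) :=
  isAlternating_of_apply (fun i j => by rw [hA.apply i j, map_neg, hφ])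
    (fun i => by rw [hA.2, map_zero])

variable {ι : Type*} [Fintype ι]

/-- Truncating a Koszul matrix entrywise preserves its relations because the `g i` are homogeneous.
Every degree estimate for syzygies below comes from here. -/
theorem IsKoszulExact.exists_truncDegree {g : ι → MvPolynomial σ R} {e : ι → ℕ}
    (hg : IsKoszulExact g) (hge : ∀ i, (g i).IsHomogeneous (e i)) (N : ℕ)
    (h : ι → MvPolynomial σ R) (hh : ∑ i, h i * g i = 0)
    (hN : ∀ i, truncDegree (N - e i) (h i) = h i) :
    ∃ A : Matrix ι ι (MvPolynomial σ R), IsAlternating A ∧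
      (∀ i j, truncDegree (N - e i - e j) (A i j) = A i j) ∧
      ∀ i, h i = ∑ j, A i j * g j := by
  obtain ⟨A, hA, hAg⟩ := hg h hh
  refine ⟨fun i j => truncDegree (N - e i - e j) (A i j), ?_, ?_, ?_⟩
  · exact hA.map (fun i j => truncDegree (N - e i - e j)) fun i j => by
      rw [Nat.sub_right_comm]
  · exact fun i j => truncDegree_truncDegree _ _
  · intro i
    rw [← hN i, hAg i, map_sum]
    exact Finset.sum_congr rfl fun j _ => truncDegree_mul (hge j) _ _

/-- Dropping the member `g i₀` from a Koszul exact family of homogeneous polynomials. -/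
theorem IsKoszulExact.drop [DecidableEq ι] {g : ι → MvPolynomial σ R} {e : ι → ℕ}
    (hg : IsKoszulExact g) (hge : ∀ i, (g i).IsHomogeneous (e i)) (i₀ : ι) (he : 0 < e i₀)
    (h : ι → MvPolynomial σ R) (hh : ∑ i, h i * g i = 0) (h0 : h i₀ = 0) :
    ∃ A : Matrix ι ι (MvPolynomial σ R), IsAlternating A ∧ (∀ j, A i₀ j = 0) ∧
      ∀ i, h i = ∑ j, A i j * g j := by
  obtain ⟨N, hN⟩ := exists_truncDegree_eq e h
  induction N using Nat.strong_induction_on generalizing h with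
  | _ N ih =>
    rcases Nat.eq_zero_or_pos N with rfl | hNpos
    · refine ⟨0, ⟨by simp, by simp⟩, by simp, fun i => ?_⟩
      rw [← hN i]
      simp [truncDegree_zero_left]
    obtain ⟨A, hA, hAN, hAg⟩ := hg.exists_truncDegree hge N h hh hN
    -- Since `h i₀ = 0`, column `i₀` of `A` is again a syzygy with zero entry at `i₀`, and its
    -- degree bound is lower by `e i₀`.
    obtain ⟨B, hB, hB0, hBg⟩ := ih (N - e i₀) (by omega) (fun i => A i i₀) (by
      have h1 := hAg i₀
      rw [h0] at h1
      rw [← neg_eq_zero, ← Finset.sum_neg_distrib, h1]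
      exact Finset.sum_congr rfl fun i _ => by rw [hA.apply i i₀, neg_mul]) (hA.2 i₀)
      (fun i => by rw [Nat.sub_right_comm]; exact hAN i i₀)
    -- Row and column `i₀` of `A` are erased; the column is redistributed over the others as `g i₀ *
    -- B`.
    refine ⟨fun i j => (if i = i₀ ∨ j = i₀ then 0 else A i j) + g i₀ * B i j, ?_, ?_, ?_⟩
    · refine isAlternating_of_apply (fun i j => ?_) (fun i => ?_)
      · by_cases hi : i = i₀ <;> by_cases hj : j = i₀ <;>
          simp [hi, hj, hA.apply i j, hB.apply i j, hB0, add_comm, hB.apply i₀]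
      · simp [hA.2, hB.2]
    · simp [hB0]
    · intro i
      simp only [add_mul, Finset.sum_add_distrib, mul_assoc, ← Finset.mul_sum, ← hBg]
      by_cases hi : i = i₀
      · subst hi
        simp [h0, hA.2]
      · rw [hAg i, ← Finset.sum_erase_add _ _ (Finset.mem_univ i₀), mul_comm (g i₀)]
        congr 1
        rw [← Finset.sum_erase_add Finset.univ _ (Finset.mem_univ i₀)]
        simp only [or_true, if_true, zero_mul, add_zero]
        refine Finset.sum_congr rfl fun j hj => ?_
        rw [if_neg (by simp [hi, Finset.ne_of_mem_erase hj])]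

/-- Replacing a member `g i₀` of a Koszul exact family by an element `f` such that some power
of `g i₀` lies in the ideal of the new family. -/
theorem IsKoszulExact.update [DecidableEq ι] {g : ι → MvPolynomial σ R} {e : ι → ℕ}
    (hg : IsKoszulExact g) (hge : ∀ i, (g i).IsHomogeneous (e i)) (i₀ : ι) (he : 0 < e i₀)
    (f : MvPolynomial σ R) (N : ℕ)
    (hN : g i₀ ^ N ∈ Ideal.span (Set.range (Function.update g i₀ f))) :
    IsKoszulExact (Function.update g i₀ f) := by
  have hsplit : ∀ (a : ι → MvPolynomial σ R) (x : MvPolynomial σ R),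
      ∑ i, a i * Function.update g i₀ x i =
        a i₀ * x + ∑ i ∈ Finset.univ.erase i₀, a i * g i := by
    intro a x
    rw [← Finset.add_sum_erase _ _ (Finset.mem_univ i₀)]
    simp only [Function.update_self]
    congr 1
    exact Finset.sum_congr rfl fun i hi => by
      rw [Function.update_of_ne (Finset.ne_of_mem_erase hi)]
  have hsplit' : ∀ a : ι → MvPolynomial σ R, ∑ i, a i * g i =
      a i₀ * g i₀ + ∑ i ∈ Finset.univ.erase i₀, a i * g i := fun a => by
    rw [← hsplit, Function.update_eq_self]
  -- `g i₀` is a nonzerodivisor modulo the other members: row `i₀` of a Koszul matrix has no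
  -- diagonal term.
  have hcancel : ∀ (n : ℕ) (x : MvPolynomial σ R),
      (∃ c : ι → MvPolynomial σ R, g i₀ ^ n * x = ∑ i ∈ Finset.univ.erase i₀, c i * g i) →
      ∃ c : ι → MvPolynomial σ R, x = ∑ i ∈ Finset.univ.erase i₀, c i * g i := by
    intro n
    induction n with
    | zero => intro x hx; simpa using hx
    | succ n ih =>
      rintro x ⟨c, hc⟩
      apply ih
      obtain ⟨A, hA, hAg⟩ := hg (Function.update (fun i => -c i) i₀ (g i₀ ^ n * x)) (by
        rw [hsplit', Function.update_self]
        have : ∑ i ∈ Finset.univ.erase i₀,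
            Function.update (fun i => -c i) i₀ (g i₀ ^ n * x) i * g i =
            -∑ i ∈ Finset.univ.erase i₀, c i * g i := by
          rw [← Finset.sum_neg_distrib]
          exact Finset.sum_congr rfl fun i hi => by
            rw [Function.update_of_ne (Finset.ne_of_mem_erase hi), neg_mul]
        rw [this, ← hc]; ring)
      refine ⟨A i₀, ?_⟩
      have := hAg i₀
      rw [hsplit', hA.2, Function.update_self, zero_mul, zero_add] at this
      exact this
  intro h hh
  rw [hsplit] at hh
  obtain ⟨u, hu⟩ := Ideal.mem_span_range_iff_exists_fun.mp hN
  rw [hsplit] at hu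
  -- Eliminating `f` between the syzygy and the expression of `g i₀ ^ N` puts `g i₀ ^ N * h i₀` in
  -- the ideal of the other members.
  obtain ⟨c, hc⟩ := hcancel N (h i₀) ⟨fun i => u i * h i₀ - u i₀ * h i, by
    have h1 : ∀ i ∈ Finset.univ.erase i₀, (u i * h i₀ - u i₀ * h i) * g i =
      h i₀ * (u i * g i) - u i₀ * (h i * g i) := fun i _ => by ring
    rw [Finset.sum_congr rfl h1, Finset.sum_sub_distrib, ← Finset.mul_sum, ← Finset.mul_sum,
      ← hu]
    linear_combination u i₀ * hh⟩
  -- Substituting `h i₀ = ∑ c i * g i` leaves a syzygy of the other members alone.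
  obtain ⟨A, hA, hA0, hAg⟩ := hg.drop hge i₀ he
    (Function.update (fun i => h i + c i * f) i₀ 0) (by
      rw [hsplit', Function.update_self, zero_mul, zero_add, ← hh, hc, Finset.sum_mul,
        ← Finset.sum_add_distrib]
      exact Finset.sum_congr rfl fun i hi => by
        rw [Function.update_of_ne (Finset.ne_of_mem_erase hi)]; ring)
    (Function.update_self ..)
  obtain ⟨B, hB, hBg⟩ := exists_alternating_of_sum_erase (Function.update g i₀ f) h i₀ c
    (Finset.univ.erase i₀) (by simp)
    (by
      rw [hc]
      exact Finset.sum_congr rfl fun i hi => by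
        rw [Function.update_of_ne (Finset.ne_of_mem_erase hi)]) A hA
    (fun j hj => by
      have h1 := hAg j
      rw [hsplit', hA.apply i₀ j, hA0, neg_zero, zero_mul, zero_add,
        Function.update_of_ne (Finset.ne_of_mem_erase hj)] at h1
      rw [Function.update_self, h1]
      exact Finset.sum_congr rfl fun i hi => by
        rw [Function.update_of_ne (Finset.ne_of_mem_erase hi)])
  rw [Finset.insert_erase (Finset.mem_univ i₀)] at hBg
  exact ⟨B, hB, fun i => hBg i (Finset.mem_univ i)⟩

end Truncation

/-! ### Forms without common zero -/

section NoCommonZero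

variable {σ ι k : Type*} [Field k]

/-- The only possible common zero of the family `g` is the origin. -/
def NoCommonZero (g : ι → MvPolynomial σ k) : Prop :=
  ∀ x : σ → k, (∀ i, eval x (g i) = 0) → x = 0

theorem constantCoeff_of_isHomogeneous {f : MvPolynomial σ k} {e : ℕ} (hf : f.IsHomogeneous e)
    (he : 0 < e) : constantCoeff f = 0 :=
  hf.coeff_eq_zero (by simpa using he.ne)

theorem NoCommonZero.mem_radical [IsAlgClosed k] [Finite σ] {g : ι → MvPolynomial σ k}
    (hg : NoCommonZero g) {p : MvPolynomial σ k} (hp : eval 0 p = 0) :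
    p ∈ (Ideal.span (Set.range g)).radical := by
  rw [← vanishingIdeal_zeroLocus_eq_radical (K := k), mem_vanishingIdeal_iff]
  intro x hx
  have : x = 0 := hg x fun i => hx _ (Ideal.subset_span ⟨i, rfl⟩)
  rw [this]
  exact hp

/-- The ideal of polynomials vanishing on the line through the origin and `z`. -/
noncomputable def lineIdeal (z : σ → k) : Ideal (MvPolynomial σ k) :=
  RingHom.ker (aeval (fun i => Polynomial.C (z i) * Polynomial.X) :
    MvPolynomial σ k →ₐ[k] Polynomial k)

instance (z : σ → k) : (lineIdeal z).IsPrime := RingHom.ker_isPrime _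

theorem mem_lineIdeal_of_isHomogeneous [Finite σ] {f : MvPolynomial σ k} {e : ℕ}
    (hf : f.IsHomogeneous e) {z : σ → k} (hz : eval z f = 0) : f ∈ lineIdeal z := by
  cases nonempty_fintype σ
  rw [lineIdeal, RingHom.mem_ker]
  have : aeval (fun i => Polynomial.C (z i) * Polynomial.X) f =
      Polynomial.C (eval z f) * (Polynomial.X : Polynomial k) ^ e := by
    rw [aeval_def, eval₂_eq', eval_eq', map_sum, Finset.sum_mul]
    refine Finset.sum_congr rfl fun m hm => ?_
    have hme : ∑ i, m i = e := by
      rw [← Finsupp.degree_eq_sum]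
      by_contra hne
      exact mem_support_iff.mp hm (hf.coeff_eq_zero hne)
    rw [← hme]
    simp only [mul_pow, Finset.prod_mul_distrib, Finset.prod_pow_eq_pow_sum, map_mul, map_prod,
      map_pow, ← mul_assoc]
    rfl
  erw [this, hz]
  simp

theorem lineIdeal_le_ker (z : σ → k) :
    lineIdeal z ≤ RingHom.ker (eval (0 : σ → k)) := by
  intro p hp
  have h1 := congrArg (Polynomial.eval 0) (RingHom.mem_ker.mp hp)
  rw [RingHom.mem_ker]
  have h2 : ((Polynomial.aeval (0 : k)).comp (aeval (fun i => Polynomial.C (z i) * Polynomial.X) :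
    MvPolynomial σ k →ₐ[k] Polynomial k)) = aeval (0 : σ → k) := by
    ext i; simp
  have h3 := DFunLike.congr_fun h2 p
  rw [AlgHom.comp_apply] at h3
  simpa [Polynomial.aeval_def, Polynomial.eval₂_eq_eval_map, aeval_eq_eval, h1] using h3.symm

theorem X_notMem_lineIdeal {z : σ → k} {i : σ} (hz : z i ≠ 0) :
    (X i : MvPolynomial σ k) ∉ lineIdeal z := by
  intro h
  have := RingHom.mem_ker.mp h
  simp [hz] at this

/-- A smaller prime `P` would give a chain `P < lineIdeal z < m` with `m` the ideal of the origin.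
But `m` is minimal over `P + (g i₀)`, so it has height at most 1 modulo `P` by Krull's principal
ideal theorem. -/
theorem lineIdeal_mem_minimalPrimes [IsAlgClosed k] [Finite σ] {g : ι → MvPolynomial σ k}
    {e : ι → ℕ} (hge : ∀ i, (g i).IsHomogeneous (e i)) (he : ∀ i, 0 < e i)
    (hg : NoCommonZero g) (i₀ : ι) {z : σ → k} (hz0 : z ≠ 0)
    (hz : ∀ i, i ≠ i₀ → eval z (g i) = 0) :
    lineIdeal z ∈ (Ideal.span (g '' {i₀}ᶜ)).minimalPrimes := by
  have hJ : Ideal.span (g '' {i₀}ᶜ) ≤ lineIdeal z := by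
    rw [Ideal.span_le]
    rintro _ ⟨i, hi, rfl⟩
    exact mem_lineIdeal_of_isHomogeneous (hge i) (hz i hi)
  obtain ⟨P, hP, hPQ⟩ := Ideal.exists_minimalPrimes_le hJ
  rcases hPQ.eq_or_lt with rfl | hlt
  · exact hP
  exfalso
  have hPp : P.IsPrime := hP.1.1
  set m : Ideal (MvPolynomial σ k) := RingHom.ker (eval (0 : σ → k)) with hm
  have hmp : m.IsPrime := RingHom.ker_isPrime _
  have hQm : lineIdeal z < m := by
    refine lt_of_le_of_ne (lineIdeal_le_ker z) fun h => ?_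
    obtain ⟨i, hi⟩ := Function.ne_iff.mp hz0
    exact X_notMem_lineIdeal hi (h ▸ by simp [hm, RingHom.mem_ker])
  have hmin : m ∈ (P ⊔ Ideal.span {g i₀}).minimalPrimes := by
    refine ⟨⟨hmp, sup_le (hPQ.trans hQm.le) ?_⟩, ?_⟩
    · rw [Ideal.span_singleton_le_iff_mem, hm, RingHom.mem_ker, eval_zero]
      exact constantCoeff_of_isHomogeneous (hge i₀) (he i₀)
    · rintro R ⟨hR, hRle⟩ - p hp
      have : Ideal.span (Set.range g) ≤ R := by
        rw [Ideal.span_le]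
        rintro _ ⟨i, rfl⟩
        by_cases hi : i = i₀
        · subst hi
          exact hRle (Ideal.mem_sup_right (Ideal.mem_span_singleton_self _))
        · exact hRle (Ideal.mem_sup_left (hP.1.2 (Ideal.subset_span ⟨i, hi, rfl⟩)))
      exact hR.radical_le_iff.mpr this (hg.mem_radical hp)
  have h1 := Ideal.map_height_le_one_of_mem_minimalPrimes hmin
  have hker : ∀ I : Ideal (MvPolynomial σ k), P ≤ I →
      RingHom.ker (Ideal.Quotient.mk P) ≤ I := fun I hI => by rwa [Ideal.mk_ker]
  have p1 : (P.map (Ideal.Quotient.mk P)).IsPrime :=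
    Ideal.map_isPrime_of_surjective Ideal.Quotient.mk_surjective (hker _ le_rfl)
  have p2 : ((lineIdeal z).map (Ideal.Quotient.mk P)).IsPrime :=
    Ideal.map_isPrime_of_surjective Ideal.Quotient.mk_surjective (hker _ hPQ)
  have p3 : (m.map (Ideal.Quotient.mk P)).IsPrime :=
    Ideal.map_isPrime_of_surjective Ideal.Quotient.mk_surjective (hker _ (hPQ.trans hQm.le))
  have hstrict : ∀ I I' : Ideal (MvPolynomial σ k), P ≤ I → I < I' →
      I.map (Ideal.Quotient.mk P) < I'.map (Ideal.Quotient.mk P) := by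
    intro I I' hI hlt
    refine lt_of_le_of_ne (Ideal.map_mono hlt.le) fun h => hlt.ne ?_
    have h' := congrArg (Ideal.comap (Ideal.Quotient.mk P)) h
    rwa [Ideal.comap_map_of_surjective' _ Ideal.Quotient.mk_surjective,
      Ideal.comap_map_of_surjective' _ Ideal.Quotient.mk_surjective, Ideal.mk_ker,
      sup_eq_left.mpr hI, sup_eq_left.mpr (hI.trans hlt.le)] at h'
  have h2 := Ideal.height_add_one_le_of_lt_of_isPrime (hstrict _ _ le_rfl hlt)
  have h3 := Ideal.height_add_one_le_of_lt_of_isPrime (hstrict _ _ hPQ hQm)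
  have h4 : (1 : ℕ∞) + 1 ≤ 1 :=
    le_trans (add_le_add_left (le_trans le_add_self h2) 1) (h3.trans h1)
  exact absurd h4 (by decide)

/-- The linear form with coefficients `c`. -/
noncomputable def linForm [Fintype σ] (c : σ → k) : MvPolynomial σ k := ∑ j, C (c j) * X j

theorem linForm_isHomogeneous [Fintype σ] (c : σ → k) : (linForm c).IsHomogeneous 1 :=
  IsHomogeneous.sum _ _ _ fun _ _ => isHomogeneous_C_mul_X _ _

@[simp]
theorem eval_linForm [Fintype σ] (c x : σ → k) : eval x (linForm c) = ∑ j, c j * x j := by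
  simp [linForm]

/-- The remaining forms vanish on finitely many lines, and a vector space over an infinite field is
not a finite union of proper subspaces. -/
theorem NoCommonZero.exists_linForm [IsAlgClosed k] [Fintype σ] [DecidableEq ι]
    {g : ι → MvPolynomial σ k}
    {e : ι → ℕ} (hge : ∀ i, (g i).IsHomogeneous (e i)) (he : ∀ i, 0 < e i)
    (hg : NoCommonZero g) (i₀ : ι) :
    ∃ c : σ → k, NoCommonZero (Function.update g i₀ (linForm c)) := by
  classical
  have : Infinite k := IsAlgClosed.instInfinite
  have hfin := Ideal.finite_minimalPrimes_of_isNoetherianRing _ (Ideal.span (g '' {i₀}ᶜ))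
  let W : Ideal (MvPolynomial σ k) → Subspace k (σ → k) := fun P =>
    { carrier := {c | linForm c ∈ P}
      add_mem' := fun {a b} ha hb => by
        have : linForm (a + b) = linForm a + linForm b := by
          simp [linForm, add_mul, Finset.sum_add_distrib]
        simpa [this] using P.add_mem ha hb
      zero_mem' := by simp [linForm]
      smul_mem' := fun r a ha => by
        have : linForm (r • a) = C r * linForm a := by
          simp [linForm, Finset.mul_sum, mul_assoc]
        simpa [this] using P.mul_mem_left _ ha }
  have hX : ∀ j : σ, linForm (Pi.single j (1 : k)) = X j := fun j => by
    simp [linForm, Pi.single_apply]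
  -- Primes containing every linear form are discarded; the ideal of a line is never one of them.
  have hne := Subspace.biUnion_ne_univ_of_top_notMem (k := k) (E := σ → k)
    (s := (hfin.toFinset.image W).erase ⊤) (by simp)
  obtain ⟨c, hc⟩ := (Set.ne_univ_iff_exists_notMem _).mp hne
  refine ⟨c, fun z hz => ?_⟩
  by_contra hz0
  have hmem := lineIdeal_mem_minimalPrimes hge he hg i₀ hz0 fun i hi => by
    simpa [Function.update_of_ne hi] using hz i
  apply hc
  simp only [Set.mem_iUnion]
  refine ⟨W (lineIdeal z), Finset.mem_erase.mpr ⟨fun h => ?_, Finset.mem_image.mpr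
    ⟨_, hfin.mem_toFinset.mpr hmem, rfl⟩⟩, ?_⟩
  · obtain ⟨j, hj⟩ := Function.ne_iff.mp hz0
    have h1 : Pi.single j (1 : k) ∈ W (lineIdeal z) := h ▸ Submodule.mem_top
    have h2 : linForm (Pi.single j (1 : k)) ∈ lineIdeal z := h1
    rw [hX] at h2
    exact X_notMem_lineIdeal hj h2
  · refine mem_lineIdeal_of_isHomogeneous (linForm_isHomogeneous c) ?_
    simpa using hz i₀

/-- As many homogeneous polynomials of positive degree as there are variables, without common
zero except the origin, form a Koszul exact family. -/
theorem NoCommonZero.isKoszulExact [IsAlgClosed k] [Fintype σ] {g : σ → MvPolynomial σ k}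
    {e : σ → ℕ} (hge : ∀ i, (g i).IsHomogeneous (e i)) (he : ∀ i, 0 < e i)
    (hg : NoCommonZero g) : IsKoszulExact g := by
  classical
  -- Outside `s` the members are linear. Each step trades one member for a generic linear form and
  -- restores it by `update`; linear forms without common zero are the variables up to an invertible
  -- matrix.
  suffices H : ∀ (s : Finset σ) (g : σ → MvPolynomial σ k) (e : σ → ℕ),
      (∀ i, (g i).IsHomogeneous (e i)) → (∀ i, 0 < e i) → NoCommonZero g →
      (∀ i ∉ s, ∃ c, g i = linForm c) → IsKoszulExact g from
    H Finset.univ g e hge he hg (by simp)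
  intro s
  induction s using Finset.induction_on with
  | empty =>
    intro g e hge he hg hlin
    choose M hM using fun i => hlin i (Finset.notMem_empty i)
    let M' : Matrix σ σ k := M
    have hdet : IsUnit M'.det := by
      rw [isUnit_iff_ne_zero]
      intro h0
      obtain ⟨v, hv, hMv⟩ := Matrix.exists_mulVec_eq_zero_iff.mpr h0
      exact hv (hg v fun i => by
        rw [hM, eval_linForm]
        exact congrFun hMv i)
    have hg' : g = (M'.map C).mulVec X := by
      ext1 i
      rw [hM]
      rfl
    rw [hg']
    refine isKoszulExact_X.mulVec _ (M'⁻¹.map C) ?_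
    rw [← Matrix.map_mul, Matrix.mul_nonsing_inv _ hdet]
    exact Matrix.map_one _ C_0 C_1
  | insert i₀ s hi ih =>
    intro g e hge he hg hlin
    obtain ⟨c, hc⟩ := hg.exists_linForm hge he i₀
    have hge' : ∀ i, (Function.update g i₀ (linForm c) i).IsHomogeneous
        (Function.update e i₀ 1 i) := by
      intro i
      by_cases h : i = i₀
      · subst h; simpa using linForm_isHomogeneous c
      · simpa [h] using hge i
    have he' : ∀ i, 0 < Function.update e i₀ 1 i := by
      intro i
      by_cases h : i = i₀
      · subst h; simp
      · simpa [h] using he i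
    have hex := ih _ _ hge' he' hc (by
      intro i his
      by_cases h : i = i₀
      · subst h; exact ⟨c, by simp⟩
      · obtain ⟨b, hb⟩ := hlin i (by simp [h, his])
        exact ⟨b, by simpa [h] using hb⟩)
    obtain ⟨N, hN⟩ := hg.mem_radical (p := linForm c) (by
      rw [eval_zero]
      exact constantCoeff_of_isHomogeneous (linForm_isHomogeneous c) one_pos)
    have := hex.update hge' i₀ (he' i₀) (g i₀) N (by simpa using hN)
    simpa using this

/-- Fewer homogeneous polynomials of positive degree than variables have a common zero different
from the origin. -/
theorem exists_common_zero [IsAlgClosed k] [Fintype σ] {g : σ → MvPolynomial σ k}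
    {e : σ → ℕ} (hge : ∀ i, (g i).IsHomogeneous (e i)) (he : ∀ i, 0 < e i)
    {i j : σ} (hij : i ≠ j) (hgij : g i = g j) : ∃ x ≠ 0, ∀ i, eval x (g i) = 0 := by
  classical
  by_contra! hno
  have hg : NoCommonZero g := fun x hx => by
    by_contra h0
    obtain ⟨i, hi⟩ := hno x h0
    exact hi (hx i)
  -- The repetition yields a syzygy with entries 1 and -1, whereas entries of Koszul syzygies vanish
  -- at the origin.
  obtain ⟨A, -, hA⟩ := hg.isKoszulExact hge he (Pi.single i 1 - Pi.single j 1) (by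
    simp [sub_mul, Pi.single_apply, hgij])
  have := congrArg (eval 0) (hA i)
  simp [hij, fun x => constantCoeff_of_isHomogeneous (hge x) (he x)] at this

end NoCommonZero

/-! ### Determinants and kernels of alternating matrices -/

section AlternatingMatrix

open Matrix

theorem IsAlternating.mapRingHom {ι R S : Type*} [CommRing R] [CommRing S] {A : Matrix ι ι R}
    (hA : IsAlternating A) (φ : R →+* S) : IsAlternating (A.map φ) :=
  hA.map (fun _ _ => φ.toAddMonoidHom) fun _ _ => rfl

theorem IsAlternating.submatrix {ι κ R : Type*} [CommRing R] {A : Matrix ι ι R}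
    (hA : IsAlternating A) (f : κ → ι) : IsAlternating (A.submatrix f f) :=
  isAlternating_of_apply (fun i j => hA.apply (f i) (f j)) fun i => hA.2 (f i)

/-- Transposition only gives `2 * det = 0`; it is applied to the generic alternating matrix over
`ℤ`, which is then specialised. -/
theorem IsAlternating.det_eq_zero {ι R : Type*} [Fintype ι] [DecidableEq ι] [CommRing R]
    {A : Matrix ι ι R} (hA : IsAlternating A) (hodd : Odd (Fintype.card ι)) : A.det = 0 := by
  classical
  let e := Fintype.equivFin ι
  let B : Matrix ι ι (MvPolynomial (ι × ι) ℤ) := Matrix.of fun i j =>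
    if e i < e j then X (i, j) else if e j < e i then -X (j, i) else 0
  have hB : B.transpose = -B := by
    ext1 i j
    simp only [B, transpose_apply, of_apply]
    rcases lt_trichotomy (e i) (e j) with h | h | h
    · simp [h, h.not_gt]
    · simp [h]
    · simp [h, h.not_gt]
  have hdet : B.det = 0 := by
    have h1 : B.det = -B.det := by
      conv_lhs => rw [← det_transpose, hB, det_neg, hodd.neg_one_pow, neg_one_mul]
    have h2 : (2 : MvPolynomial (ι × ι) ℤ) * B.det = 0 := by linear_combination h1
    exact (mul_eq_zero.mp h2).resolve_left two_ne_zero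
  have hmap : A = B.map (eval₂Hom (Int.castRingHom R) fun x => A x.1 x.2) := by
    ext i j
    simp only [B, map_apply, of_apply]
    rcases lt_trichotomy (e i) (e j) with h | h | h
    · simp [h]
    · have := e.injective h
      subst this
      simp [hA.2]
    · simp [h, h.not_gt, hA.apply j i]
  rw [hmap, ← RingHom.mapMatrix_apply, ← RingHom.map_det, hdet, map_zero]

theorem IsAlternating.inv {ι k : Type*} [Fintype ι] [DecidableEq ι] [Field k]
    {A : Matrix ι ι k} (hA : IsAlternating A) (hdet : A.det ≠ 0) : IsAlternating A⁻¹ := by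
  have hu : IsUnit A.det := isUnit_iff_ne_zero.mpr hdet
  have h := hA.conj (A⁻¹)
  have h1 : A⁻¹ᵀ * A * A⁻¹ = -A⁻¹ := by
    rw [Matrix.mul_assoc, Matrix.mul_nonsing_inv _ hu, Matrix.mul_one, transpose_nonsing_inv,
      hA.1]
    refine inv_eq_left_inv ?_
    rw [neg_mul_neg, nonsing_inv_mul _ hu]
  rw [h1] at h
  exact ⟨neg_injective h.1, fun i => by simpa using h.2 i⟩

theorem exists_isUnit_det_row {n : ℕ} {k : Type*} [Field k] {c : Fin (n + 1) → k} (hc : c ≠ 0) :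
    ∃ M : Matrix (Fin (n + 1)) (Fin (n + 1)) k, M.det ≠ 0 ∧ M 0 = c := by
  obtain ⟨i, hi⟩ := Function.ne_iff.mp hc
  refine ⟨((1 : Matrix (Fin (n + 1)) (Fin (n + 1)) k).updateRow i c).submatrix
    (Equiv.swap 0 i) id, ?_, ?_⟩
  · have h := det_updateRow_sum (1 : Matrix (Fin (n + 1)) (Fin (n + 1)) k) i c
    have h1 : ∑ l, c l • (1 : Matrix (Fin (n + 1)) (Fin (n + 1)) k) l = c := by
      ext j
      simp [Finset.sum_apply, one_apply]
    rw [h1] at h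
    rw [det_permute, h]
    refine mul_ne_zero ?_ (by simpa using hi)
    rcases Int.units_eq_one_or (Equiv.Perm.sign (Equiv.swap 0 i)) with h | h <;> simp [h]
  · ext j
    simp

/-- A singular alternating matrix of even size has two independent vectors in its kernel. -/
theorem IsAlternating.exists_vecMul_eq_zero_pair {n : ℕ} {k : Type*} [Field k]
    {A : Matrix (Fin (n + 1)) (Fin (n + 1)) k} (hA : IsAlternating A) (hn : Odd n)
    (hdet : A.det = 0) :
    ∃ v w : Fin (n + 1) → k, v ᵥ* A = 0 ∧ w ᵥ* A = 0 ∧ ∃ i j, v i * w j ≠ v j * w i := by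
  obtain ⟨v, hv, hvA⟩ := exists_vecMul_eq_zero_iff.mpr hdet
  obtain ⟨i, hi⟩ := Function.ne_iff.mp hv
  -- Deleting row and column `i`, where `v i ≠ 0`, leaves an alternating matrix of odd size, hence
  -- singular.
  obtain ⟨w, hw, hwA⟩ := exists_vecMul_eq_zero_iff.mpr
    ((hA.submatrix i.succAbove).det_eq_zero (by simpa using hn))
  have hwA' : ∀ j, ∑ l, w l * A (i.succAbove l) (i.succAbove j) = 0 := fun j => congrFun hwA j
  obtain ⟨j, hj⟩ := Function.ne_iff.mp hw
  have hvA' : ∀ j, ∑ l, v l * A l j = 0 := fun j => congrFun hvA j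
  refine ⟨v, i.insertNth 0 w, hvA, ?_, i, i.succAbove j, ?_⟩
  · ext l
    have hl : (i.insertNth 0 w ᵥ* A : Fin (n + 1) → k) l
        = ∑ m, w m * A (i.succAbove m) l := by
      simp [vecMul, dotProduct, Fin.sum_univ_succAbove _ i]
    rw [hl]
    rcases Fin.eq_self_or_eq_succAbove i l with rfl | ⟨l, rfl⟩
    -- The equation of the deleted column, multiplied by the nonzero `v` entry there, follows by
    -- pairing `w` with the equations of `v`.
    · have h1 : ∀ m, ∑ l', v l' * A l' (l.succAbove m) = 0 := fun m => hvA' _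
      have h2 : ∑ m, w m * ∑ l', v l' * A l' (l.succAbove m) = 0 := by simp [h1]
      simp only [Fin.sum_univ_succAbove _ l, mul_add, Finset.sum_add_distrib] at h2
      have h3 : ∑ m, w m * ∑ l', v (l.succAbove l') * A (l.succAbove l') (l.succAbove m) = 0 := by
        simp only [Finset.mul_sum]
        rw [Finset.sum_comm]
        refine Finset.sum_eq_zero fun l' _ => ?_
        have := hwA' l'
        calc _ = -v (l.succAbove l') * ∑ m, w m * A (l.succAbove m) (l.succAbove l') := by
              rw [Finset.mul_sum]
              exact Finset.sum_congr rfl fun m _ => by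
                rw [hA.apply (l.succAbove m) (l.succAbove l')]; ring
          _ = 0 := by rw [this, mul_zero]
      rw [h3, add_zero] at h2
      have h4 : v l * ∑ m, w m * A (l.succAbove m) l = 0 := by
        rw [← neg_eq_zero, ← h2, Finset.mul_sum, ← Finset.sum_neg_distrib]
        exact Finset.sum_congr rfl fun m _ => by
          rw [hA.apply l (l.succAbove m)]; ring
      simpa using (mul_eq_zero.mp h4).resolve_left hi
    · exact hwA' l
  · simpa using ⟨hi, hj⟩

end AlternatingMatrix

/-! ### Consequences of smoothness -/

section Smooth

variable {K : Type*} [Field K] {n : ℕ} {F : MvPolynomial (Fin (n + 1)) K}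

/-- Otherwise powers of both `X 0` and `X (Fin.last n)` are multiples of `G`, which unique
factorisation forbids for a nonunit. -/
theorem exists_isGeomPoint_of_not_isUnit (hn : 1 ≤ n) {G : MvPolynomial (Fin (n + 1)) K}
    (hG : ¬ IsUnit G) : ∃ P, IsGeomPoint G P := by
  by_contra! hno
  have hX : ∀ i : Fin (n + 1), X i ∈ (Ideal.span {G}).radical := by
    intro i
    rw [← vanishingIdeal_zeroLocus_eq_radical (K := AlgebraicClosure K), mem_vanishingIdeal_iff]
    intro x hx
    have hx0 : x = 0 := by
      by_contra h
      exact hno x ⟨h, hx G (Ideal.mem_span_singleton_self G)⟩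
    simp [hx0]
  obtain ⟨N, hN⟩ := hX 0
  obtain ⟨N', hN'⟩ := hX (Fin.last n)
  rw [Ideal.mem_span_singleton] at hN hN'
  obtain ⟨j, -, hj⟩ := (dvd_prime_pow (X_prime (i := 0)) N).mp hN
  rcases Nat.eq_zero_or_pos j with rfl | hjpos
  · exact hG (associated_one_iff_isUnit.mp (by simpa using hj))
  · have h1 : (X 0 : MvPolynomial (Fin (n + 1)) K) ∣ X (Fin.last n) ^ N' :=
      ((dvd_pow_self _ hjpos.ne').trans hj.symm.dvd).trans hN'
    have h2 := (X_prime (R := K) (i := (0 : Fin (n + 1)))).dvd_of_dvd_pow h1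
    rw [X_dvd_X] at h2
    have := congrArg Fin.val h2
    simp at this
    omega

theorem IsSmooth.squarefree (hn : 1 ≤ n) (hF : IsSmooth F) : Squarefree F := by
  rintro G ⟨H, hH⟩
  by_contra hG
  obtain ⟨P, hP0, hP⟩ := exists_isGeomPoint_of_not_isUnit hn hG
  obtain ⟨i, hi⟩ := hF P ⟨hP0, by rw [hH]; simp [hP]⟩
  exact hi (by rw [hH]; simp [hP])

theorem IsSmooth.ne_zero (hF : IsSmooth F) : F ≠ 0 := by
  rintro rfl
  obtain ⟨i, hi⟩ := hF 1 ⟨one_ne_zero, by simp⟩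
  simp at hi

/-- The hypersurface `F` is a factor of `F_{1,0}` if it is Frobenius nonclassical. -/
theorem IsFrobeniusNonclassical.dvd_F10 [Fintype K] (hn : 1 ≤ n) (hF : IsSmooth F)
    (hFN : IsFrobeniusNonclassical F) : F ∣ F10 F := by
  have hmem : F10 F ∈ (Ideal.span {F}).radical := by
    rw [← vanishingIdeal_zeroLocus_eq_radical (K := AlgebraicClosure K), mem_vanishingIdeal_iff]
    intro x hx
    by_cases h0 : x = 0
    · simp [F10, h0, Fintype.card_ne_zero]
    · have := hFN x ⟨h0, hx F (Ideal.mem_span_singleton_self F)⟩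
      simpa [F10, tangentSpace] using this
  obtain ⟨N, hN⟩ := hmem
  exact (hF.squarefree hn).isRadical N _ (Ideal.mem_span_singleton.mp hN)

theorem IsSmooth.noCommonZero_pderiv {d : ℕ} (hF : F.IsHomogeneous d) (hs : IsSmooth F)
    (hd : (d : K) ≠ 0) :
    NoCommonZero fun i => map (algebraMap K (AlgebraicClosure K)) (pderiv i F) := by
  intro P hP
  by_contra h0
  have hP' : ∀ i, aeval P (pderiv i F) = 0 := fun i => by
    rw [aeval_def, ← eval_map]; exact hP i
  have h1 := congrArg (aeval P) hF.sum_X_mul_pderiv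
  have h2 : (d : AlgebraicClosure K) ≠ 0 := by
    have := (map_ne_zero (algebraMap K (AlgebraicClosure K))).mpr hd
    rwa [map_natCast] at this
  simp [hP', h2] at h1
  obtain ⟨i, hi⟩ := hs P ⟨h0, h1⟩
  exact hi (hP' i)

theorem truncDegree_map {σ R S : Type*} [CommRing R] [CommRing S] (φ : R →+* S) (m : ℕ)
    (f : MvPolynomial σ R) : truncDegree m (map φ f) = map φ (truncDegree m f) := by
  ext a
  simp only [coeff_map, coeff_truncDegree]
  split_ifs <;> simp

theorem isHomogeneous_pderiv {d : ℕ} (hF : F.IsHomogeneous d) (i : Fin (n + 1)) :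
    (pderiv i F).IsHomogeneous (d - 1) := hF.pderiv

/-- Syzygies in low degree of the partial derivatives, when the characteristic does not divide
the degree. -/
theorem IsSmooth.syzygy_pderiv {d q : ℕ} (hd : 2 ≤ d) (hF : F.IsHomogeneous d) (hs : IsSmooth F)
    (hdK : (d : K) ≠ 0) (s : Fin (n + 1) → MvPolynomial (Fin (n + 1)) K)
    (hsq : ∀ i, truncDegree (q + 1) (s i) = s i) (hsyz : ∑ i, s i * pderiv i F = 0) :
    (q + 1 < d → ∀ i, s i = 0) ∧ (d = q + 1 → ∃ A : Matrix (Fin (n + 1)) (Fin (n + 1)) K,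
      IsAlternating A ∧ ∀ i, s i = ∑ j, C (A i j) * pderiv j F) := by
  set φ := algebraMap K (AlgebraicClosure K) with hφ
  have hhom : ∀ i, (map φ (pderiv i F)).IsHomogeneous (d - 1) := fun i =>
    (isHomogeneous_pderiv hF i).map φ
  -- The bound makes the entries of `A` have degree below q + 2 - d: zero for d > q + 1, constant
  -- for d = q + 1.
  obtain ⟨A, hA, hAN, hAs⟩ := ((hs.noCommonZero_pderiv hF hdK).isKoszulExact hhom
    (fun _ => by omega)).exists_truncDegree hhom (q + 1 + (d - 1)) (fun i => map φ (s i))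
    (by
      have := congrArg (map φ) hsyz
      simpa using this)
    (fun i => by rw [truncDegree_map, Nat.add_sub_cancel, hsq])
  constructor
  · intro hlt i
    have hA0 : ∀ i j, A i j = 0 := fun i j => by
      rw [← hAN i j, show q + 1 + (d - 1) - (d - 1) - (d - 1) = 0 by omega, truncDegree_zero_left]
    apply map_injective φ φ.injective
    rw [map_zero, hAs i]
    simp [hA0]
  · intro hdq
    have hA0 : ∀ i j, A i j = C (coeff 0 (A i j)) := fun i j => by
      conv_lhs => rw [← hAN i j, show q + 1 + (d - 1) - (d - 1) - (d - 1) = 1 by omega,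
        truncDegree_one_left]
    -- A `K`-linear retraction of the closure onto `K` brings the constant matrix down to `K`.
    obtain ⟨π, hπ⟩ := (Algebra.linearMap K (AlgebraicClosure K)).exists_leftInverse_of_injective
      (LinearMap.ker_eq_bot.mpr φ.injective)
    have hπ' : ∀ x, π (φ x) = x := fun x => LinearMap.congr_fun hπ x
    refine ⟨fun i j => π (coeff 0 (A i j)), ?_, fun i => ?_⟩
    · exact isAlternating_of_apply (fun i j => by rw [hA.apply i j]; simp)
        fun i => by rw [hA.2]; simp
    · ext m
      have h1 := congrArg (coeff m) (hAs i)
      simp only [coeff_sum, coeff_map] at h1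
      rw [← hπ' (coeff m (s i)), h1, map_sum, coeff_sum]
      refine Finset.sum_congr rfl fun j _ => ?_
      rw [hA0 i j, coeff_C_mul, coeff_C_mul, coeff_map, mul_comm, ← Algebra.smul_def, map_smul,
        smul_eq_mul, mul_comm]

theorem IsSmooth.exists_pderiv_ne_zero (hn : 1 ≤ n) {d : ℕ} (hd : 0 < d) (hF : F.IsHomogeneous d)
    (hs : IsSmooth F) : ∃ i, pderiv i F ≠ 0 := by
  have hu : ¬ IsUnit F := fun h => by
    have h1 := h.map (constantCoeff (σ := Fin (n + 1)) (R := K))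
    rw [constantCoeff_of_isHomogeneous hF hd] at h1
    exact not_isUnit_zero h1
  obtain ⟨P, hP⟩ := exists_isGeomPoint_of_not_isUnit hn hu
  obtain ⟨i, hi⟩ := hs P hP
  exact ⟨i, fun h => hi (by rw [h, map_zero])⟩

end Smooth

/-! ### Rational points and lower bounds on the degree -/

section FiniteField

variable {K : Type*} [Field K] [Fintype K] {n d : ℕ} {F : MvPolynomial (Fin (n + 1)) K}

theorem pderiv_X_pow_card_mul {σ : Type*} (k i : σ) (f : MvPolynomial σ K) :
    pderiv k (X i ^ Fintype.card K * f) = X i ^ Fintype.card K * pderiv k f := by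
  have h : pderiv k (X i ^ Fintype.card K : MvPolynomial σ K) = 0 := by
    rw [pderiv_pow, ← map_natCast (C : K →+* MvPolynomial σ K)]
    simp
  rw [pderiv_mul, h, zero_mul, zero_add]

/-- At rational points F_{1,0} agrees with Euler's sum d F, so F vanishes at all of them, impossible
for a nonzero form of degree at most q. -/
theorem card_lt_of_F10_eq_zero (hs : IsSmooth F) (hF : F.IsHomogeneous d) (hd : (d : K) ≠ 0)
    (h10 : F10 F = 0) : Fintype.card K < d := by
  by_contra! hle
  refine hs.ne_zero (hF.eq_zero_of_forall_eval_eq_zero_of_le_card (fun P => ?_)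
    (by rw [Cardinal.mk_fintype]; exact_mod_cast hle))
  have h1 := congrArg (eval P) hF.sum_X_mul_pderiv
  have h2 := congrArg (eval P) h10
  simp only [F10, map_sum, map_mul, map_pow, eval_X, FiniteField.pow_card, map_zero] at h2
  simp only [map_sum, map_mul, eval_X, h2, nsmul_eq_mul, map_natCast] at h1
  exact (mul_eq_zero.mp h1.symm).resolve_left hd

/-- Differentiating Euler's formula and F_{1,0} = 0 gives F_k + ∑ x_i F_ik = 0 and ∑ x_i^q F_ik = 0;
the two sums agree at rational points. -/
theorem eval_pderiv_eq_zero (hF : F.IsHomogeneous d) (hd : (d : K) = 0)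
    (h10 : F10 F = 0) (k : Fin (n + 1)) (P : Fin (n + 1) → K) : eval P (pderiv k F) = 0 := by
  have h1 : pderiv k (∑ i, X i * pderiv i F) = 0 := by
    rw [hF.sum_X_mul_pderiv, nsmul_eq_mul, ← map_natCast (C : K →+* _), hd]
    simp
  have h2 : pderiv k (F10 F) = 0 := by rw [h10, map_zero]
  have h1' := congrArg (eval P) h1
  have h2' := congrArg (eval P) h2
  simp only [F10, map_sum, pderiv_X_pow_card_mul, map_mul, map_pow, eval_X, map_zero,
    FiniteField.pow_card] at h2'
  simp only [map_sum, pderiv_mul, map_add, map_mul, eval_X, map_zero, Finset.sum_add_distrib,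
    h2', pderiv_X] at h1'
  simpa [Pi.single_apply, apply_ite] using h1'

theorem add_two_le_of_F10_eq_zero (hn : 1 ≤ n) (h0 : 0 < d) (hs : IsSmooth F)
    (hF : F.IsHomogeneous d) (hd : (d : K) = 0) (h10 : F10 F = 0) : Fintype.card K + 2 ≤ d := by
  by_contra! hlt
  obtain ⟨i, hi⟩ := hs.exists_pderiv_ne_zero hn h0 hF
  refine hi ((isHomogeneous_pderiv hF i).eq_zero_of_forall_eval_eq_zero_of_le_card
    (eval_pderiv_eq_zero hF hd h10 i) ?_)
  rw [Cardinal.mk_fintype]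
  exact_mod_cast (by omega : d - 1 ≤ Fintype.card K)

end FiniteField

/-! ### Linear forms and their q-twists -/

section PowForm

variable {k : Type*} [Field k] {σ : Type*} [Fintype σ]

/-- The form `∑ j, c_j x_j ^ q`. -/
noncomputable def powForm (q : ℕ) (c : σ → k) : MvPolynomial σ k := ∑ j, C (c j) * X j ^ q

theorem powForm_isHomogeneous (q : ℕ) (c : σ → k) : (powForm q c).IsHomogeneous q :=
  IsHomogeneous.sum _ _ _ fun _ _ => isHomogeneous_C_mul_X_pow _ _ _

/-- Put x_i = T, x_j = 1 and the other variables 0, and compare coefficients of T. -/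
theorem linForm_mul_powForm_comm {q : ℕ} (hq : 2 ≤ q) {c w : σ → k}
    (h : linForm c * powForm q w = powForm q c * linForm w) (i j : σ) :
    c i * w j = c j * w i := by
  classical
  by_cases hij : i = j
  · rw [hij]
  have h1 := congrArg (fun f => Polynomial.coeff (aeval (R := k) (fun l : σ =>
    if l = i then (Polynomial.X : Polynomial k) else if l = j then 1 else 0) f) 1) h
  have hlin : ∀ c : σ → k, aeval (R := k) (fun l : σ =>
      if l = i then (Polynomial.X : Polynomial k) else if l = j then 1 else 0) (linForm c) =
      Polynomial.C (c i) * Polynomial.X + Polynomial.C (c j) := fun c => by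
    rw [linForm, map_sum, ← Finset.add_sum_erase _ _ (Finset.mem_univ i),
      ← Finset.add_sum_erase _ _ (Finset.mem_erase.mpr ⟨Ne.symm hij, Finset.mem_univ j⟩),
      Finset.sum_eq_zero]
    · simp [Ne.symm hij, Polynomial.algebraMap_eq]
    · intro l hl
      simp only [Finset.mem_erase] at hl
      simp [hl.1, hl.2.1]
  have hpow : ∀ c : σ → k, aeval (R := k) (fun l : σ =>
      if l = i then (Polynomial.X : Polynomial k) else if l = j then 1 else 0) (powForm q c) =
      Polynomial.C (c i) * Polynomial.X ^ q + Polynomial.C (c j) := fun c => by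
    rw [powForm, map_sum, ← Finset.add_sum_erase _ _ (Finset.mem_univ i),
      ← Finset.add_sum_erase _ _ (Finset.mem_erase.mpr ⟨Ne.symm hij, Finset.mem_univ j⟩),
      Finset.sum_eq_zero]
    · simp [Ne.symm hij, Polynomial.algebraMap_eq]
    · intro l hl
      simp only [Finset.mem_erase] at hl
      simp [hl.1, hl.2.1, show q ≠ 0 by omega]
  obtain ⟨r, rfl⟩ : ∃ r, q = r + 2 := ⟨q - 2, by omega⟩
  simp only [map_mul, hlin, hpow] at h1
  have e1 : ∀ a b a' b' : k, ((Polynomial.C a * Polynomial.X + Polynomial.C b) *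
      (Polynomial.C a' * Polynomial.X ^ (r + 2) + Polynomial.C b')).coeff 1 = a * b' := by
    intro a b a' b'
    have : (Polynomial.C a * Polynomial.X + Polynomial.C b) *
      (Polynomial.C a' * Polynomial.X ^ (r + 2) + Polynomial.C b') =
      Polynomial.C (a * b') * Polynomial.X + Polynomial.C (b * b') +
      Polynomial.X ^ 2 * ((Polynomial.C a * Polynomial.X + Polynomial.C b) *
        (Polynomial.C a' * Polynomial.X ^ r)) := by
      simp only [map_mul]; ring
    rw [this]
    simp [Polynomial.coeff_X_pow_mul', Polynomial.coeff_C]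
  rw [e1, mul_comm (Polynomial.C (c i) * Polynomial.X ^ (r + 2) + _), e1] at h1
  rw [h1, mul_comm]

end PowForm

/-! ### A nowhere tangent hyperplane -/

section Transversal

variable {k : Type*} [Field k] {n : ℕ}

/-- The polynomials `f i` in `n + 1` variables satisfy a nontrivial algebraic relation modulo any
nonzero polynomial `F`, provided that there are at least `n + 1` of them. -/
theorem exists_relation_mod {F : MvPolynomial (Fin (n + 1)) k} (hF : F ≠ 0)
    (f : Fin (n + 1) → MvPolynomial (Fin (n + 1)) k) :
    ∃ Φ : MvPolynomial (Fin (n + 1)) k, Φ ≠ 0 ∧ F ∣ aeval f Φ := by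
  by_cases hf : AlgebraicIndependent k f
  -- By transcendence degree `F` is algebraic over `k[f]`; the nonzero constant coefficient of a
  -- relation is a multiple of `F`.
  · have hdep : ¬ AlgebraicIndependent k (fun o : Option (Fin (n + 1)) => o.elim F f) := by
      intro h
      have h1 := h.lift_cardinalMk_le_trdeg
      rw [MvPolynomial.trdeg_of_isDomain] at h1
      simp only [Cardinal.mk_fintype, Fintype.card_option, Fintype.card_fin,
        Cardinal.lift_natCast, Nat.cast_le] at h1
      omega
    rw [hf.option_iff_transcendental, Transcendental, not_not] at hdep
    obtain ⟨p, hp0, hp⟩ := hdep.exists_nonzero_coeff_and_aeval_eq_zero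
      (mem_nonZeroDivisors_of_ne_zero hF)
    obtain ⟨Φ, hΦ⟩ : (p.coeff 0 : MvPolynomial (Fin (n + 1)) k) ∈
        (aeval (R := k) f).range := by
      rw [← Algebra.adjoin_range_eq_range_aeval]
      exact (p.coeff 0).2
    refine ⟨Φ, ?_, ?_⟩
    · rintro rfl
      apply hp0
      ext1
      rw [← hΦ]
      simp
    · have h2 := congrArg (Polynomial.aeval F) (Polynomial.divX_mul_X_add p)
      rw [hp, map_add, map_mul, Polynomial.aeval_X, Polynomial.aeval_C] at h2
      have h3 : aeval f Φ = algebraMap _ _ (p.coeff 0) := hΦ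
      rw [h3]
      exact ⟨-Polynomial.aeval F p.divX, by linear_combination h2⟩
  · rw [algebraicIndependent_iff] at hf
    push Not at hf
    obtain ⟨Φ, hΦ, hΦ0⟩ := hf
    exact ⟨Φ, hΦ0, by rw [hΦ]; exact dvd_zero _⟩

theorem eval_smul_of_isHomogeneous {σ : Type*} {f : MvPolynomial σ k} {e : ℕ}
    (hf : f.IsHomogeneous e) (r : k) (P : σ → k) : eval (r • P) f = r ^ e * eval P f := by
  rw [eval_eq, eval_eq, Finset.mul_sum]
  refine Finset.sum_congr rfl fun m hm => ?_
  have : m.degree = e := by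
    by_contra hne
    exact mem_support_iff.mp hm (hf.coeff_eq_zero hne)
  simp only [Pi.smul_apply, smul_eq_mul, mul_pow, Finset.prod_mul_distrib,
    Finset.prod_pow_eq_pow_sum]
  rw [← this, Finsupp.degree_apply]
  ring

variable [IsAlgClosed k] {F : MvPolynomial (Fin (n + 1)) k} {d : ℕ}

/-- The existence of a hyperplane `∑ i, c_i x_i = 0` which is nowhere tangent to the smooth
hypersurface `F`. -/
theorem exists_not_tangent (hd : 2 ≤ d) (hF : F.IsHomogeneous d) (hF0 : F ≠ 0)
    (hs : ∀ P ≠ 0, eval P F = 0 → ∃ i, eval P (pderiv i F) ≠ 0) :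
    ∃ c : Fin (n + 1) → k, c ≠ 0 ∧ ∀ P ≠ 0, eval P F = 0 →
      ∀ r : k, ¬ ∀ i, eval P (pderiv i F) = r * c i := by
  have : Infinite k := IsAlgClosed.instInfinite
  -- `Φ` vanishes on all gradients at points of the hypersurface; `c` is chosen off `Φ = 0`, the
  -- factor `X 0` ensuring `c ≠ 0`.
  obtain ⟨Φ, hΦ0, hΦ⟩ := exists_relation_mod hF0 fun i => pderiv i F
  obtain ⟨c, hc⟩ : ∃ c, eval c (Φ * X 0) ≠ 0 := by
    by_contra! h
    exact mul_ne_zero hΦ0 (X_ne_zero _) (MvPolynomial.funext fun x => by rw [h x, map_zero])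
  rw [map_mul, eval_X] at hc
  refine ⟨c, fun h => right_ne_zero_of_mul hc (by rw [h]; rfl), fun P hP0 hP r hr => ?_⟩
  obtain ⟨i, hi⟩ := hs P hP0 hP
  have hr0 : r ≠ 0 := by
    rintro rfl
    exact hi (by rw [hr i, zero_mul])
  -- Rescaling `P` makes the gradient equal to `c`.
  obtain ⟨μ, hμ⟩ := IsAlgClosed.exists_pow_nat_eq r⁻¹ (show 0 < d - 1 by omega)
  have hc' : ∀ i, eval (μ • P) (pderiv i F) = c i := fun i => by
    rw [eval_smul_of_isHomogeneous hF.pderiv, hμ, hr i, inv_mul_cancel_left₀ hr0]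
  have hF' : eval (μ • P) F = 0 := by
    rw [eval_smul_of_isHomogeneous hF, hP, mul_zero]
  obtain ⟨H, hH⟩ := hΦ
  have h1 := congrArg (eval (μ • P)) hH
  rw [map_mul, hF', zero_mul] at h1
  have h2 : eval (μ • P) (aeval (fun i => pderiv i F) Φ) = eval c Φ := by
    have h3 : (aeval (R := k) (μ • P)).comp (aeval fun i => pderiv i F) = aeval c := by
      ext i
      simpa [aeval_eq_eval] using hc' i
    simpa [aeval_eq_eval] using DFunLike.congr_fun h3 Φ
  exact left_ne_zero_of_mul hc (h2 ▸ h1)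

end Transversal

/-! ### Degrees divisible by the characteristic -/

section Syzygy

open Matrix

variable {k : Type*} [Field k] {n d q : ℕ} {F : MvPolynomial (Fin (n + 1)) k}

/-- If `M` is invertible with first row `c`, then the linear forms given by the other rows
of `M` are independent modulo the first one, in a strong sense. -/
theorem eq_zero_of_linForm_mul_powForm (hq : 2 ≤ q)
    {M : Matrix (Fin (n + 1)) (Fin (n + 1)) k} (hM : M.det ≠ 0) (w : Fin n → k)
    (hw : ∑ j, C (w j) * (linForm (M 0) * powForm q (M j.succ) -
      powForm q (M 0) * linForm (M j.succ)) = 0) : w = 0 := by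
  set b : Fin (n + 1) → k := fun i => ∑ j, w j * M j.succ i with hb
  have hlin : ∑ j, C (w j) * linForm (M j.succ) = linForm b := by
    simp only [linForm, hb, Finset.mul_sum, map_sum, Finset.sum_mul, map_mul]
    rw [Finset.sum_comm]
    exact Finset.sum_congr rfl fun _ _ => Finset.sum_congr rfl fun _ _ => by ring
  have hpow : ∑ j, C (w j) * powForm q (M j.succ) = powForm q b := by
    simp only [powForm, hb, Finset.mul_sum, map_sum, Finset.sum_mul, map_mul]
    rw [Finset.sum_comm]
    exact Finset.sum_congr rfl fun _ _ => Finset.sum_congr rfl fun _ _ => by ring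
  have key : linForm (M 0) * powForm q b = powForm q (M 0) * linForm b := by
    rw [← hlin, ← hpow, ← sub_eq_zero, ← hw, Finset.mul_sum, Finset.mul_sum,
      ← Finset.sum_sub_distrib]
    exact Finset.sum_congr rfl fun _ _ => by ring
  have hcomm := linForm_mul_powForm_comm hq key
  have hM0 : M 0 ≠ 0 := fun h => hM (det_eq_zero_of_row_eq_zero 0 (congrFun h))
  obtain ⟨i, hi⟩ := Function.ne_iff.mp hM0
  have hv : (Fin.cons (b i) fun j => -(M 0 i * w j) : Fin (n + 1) → k) = 0 := by
    by_contra hne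
    refine hM (exists_vecMul_eq_zero_iff.mp ⟨_, hne, ?_⟩)
    ext j
    have h1 : ∑ x, -(M 0 i * w x) * M x.succ j = -(M 0 i * b j) := by
      simp only [hb, Finset.mul_sum, ← Finset.sum_neg_distrib]
      exact Finset.sum_congr rfl fun _ _ => by ring
    simp only [vecMul, dotProduct, Fin.sum_univ_succ, Fin.cons_zero, Fin.cons_succ, h1,
      hcomm i j, Pi.zero_apply]
    ring
  ext j
  have := congrFun hv j.succ
  simpa using (mul_eq_zero.mp (by simpa using this : M 0 i * w j = 0)).resolve_left hi

theorem sum_mulVec_mul_mulVec {R : Type*} [CommRing R] {m : ℕ} (M g : Matrix (Fin m) (Fin m) R)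
    (h : g * M = 1) (u f : Fin m → R) :
    ∑ j, (∑ l, M j l * u l) * (∑ i, g i j * f i) = ∑ i, u i * f i := by
  have : (M *ᵥ u) ⬝ᵥ (f ᵥ* g) = u ⬝ᵥ f := by
    rw [dotProduct_comm, ← dotProduct_mulVec, mulVec_mulVec, h, one_mulVec, dotProduct_comm]
  rw [← show u ⬝ᵥ f = ∑ i, u i * f i from rfl, ← this]
  simp only [dotProduct, mulVec, vecMul, mul_comm (f _)]

/-- The span of the monomials `x_a x_b ^ q`. -/
noncomputable def frobeniusSpan (k : Type*) [Field k] (σ : Type*) (q : ℕ) :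
    Submodule k (MvPolynomial σ k) :=
  Submodule.span k (Set.range fun ab : σ × σ => X ab.1 * X ab.2 ^ q)

theorem linForm_mul_powForm_mem (c w : Fin (n + 1) → k) :
    linForm c * powForm q w ∈ frobeniusSpan k (Fin (n + 1)) q := by
  rw [linForm, powForm, Finset.sum_mul_sum]
  refine sum_mem fun i _ => sum_mem fun j _ => ?_
  have : C (c i) * X i * (C (w j) * X j ^ q) =
      (c i * w j) • (X i * X j ^ q : MvPolynomial (Fin (n + 1)) k) := by
    rw [smul_eq_C_mul, map_mul]; ring
  rw [this]
  exact Submodule.smul_mem _ _ (Submodule.subset_span ⟨(i, j), rfl⟩)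

theorem C_mul_mem {σ : Type*} {W : Submodule k (MvPolynomial σ k)} (a : k) {f : MvPolynomial σ k}
    (hf : f ∈ W) : C a * f ∈ W := by
  rw [← smul_eq_C_mul]
  exact W.smul_mem a hf

/-- Smooth hypersurfaces whose degree is divisible by the characteristic and whose partial
derivatives satisfy `∑ i, x_i ^ q * F_i = H * F`. -/
theorem degree_le_of_cast_eq_zero [IsAlgClosed k] (hn : 2 ≤ n) (hq : 2 ≤ q) (hd : 2 ≤ d)
    (hF : F.IsHomogeneous d) (hF0 : F ≠ 0)
    (hs : ∀ P ≠ 0, eval P F = 0 → ∃ i, eval P (pderiv i F) ≠ 0) (hdk : (d : k) = 0)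
    (H : MvPolynomial (Fin (n + 1)) k) (hH : truncDegree q H = H)
    (hHF : ∑ i, X i ^ q * pderiv i F = H * F) :
    d ≤ q + 2 ∧ (d = q + 2 → H = 0 ∧ n = 2 ∧
      ∀ i, pderiv i F ∈ frobeniusSpan k (Fin (n + 1)) q) := by
  obtain ⟨c, hc0, hc⟩ := exists_not_tangent hd hF hF0 hs
  obtain ⟨M, hM, rfl⟩ := exists_isUnit_det_row hc0
  set g := M⁻¹ with hg
  have hgM : g * M = 1 := nonsing_inv_mul _ (isUnit_iff_ne_zero.mpr hM)
  -- The derivatives of `F` in the coordinates `linForm (M j)`.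
  set G : Fin (n + 1) → MvPolynomial (Fin (n + 1)) k := fun j => ∑ i, C (g i j) * pderiv i F
    with hG
  have hGF : ∀ i, pderiv i F = ∑ j, C (M j i) * G j := by
    intro i
    have h1 : ∀ l, ∑ j, C (M j i) * (C (g l j) * pderiv l F) =
        C ((g * M) l i) * pderiv l F := by
      intro l
      rw [mul_apply, map_sum, Finset.sum_mul]
      exact Finset.sum_congr rfl fun j _ => by rw [map_mul]; ring
    simp only [hG, Finset.mul_sum]
    rw [Finset.sum_comm]
    simp only [h1, hgM, one_apply]
    simp
  have hpair : ∀ u : Fin (n + 1) → MvPolynomial (Fin (n + 1)) k,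
      ∑ j, (∑ l, C (M j l) * u l) * G j = ∑ i, u i * pderiv i F := fun u =>
    sum_mulVec_mul_mulVec (M.map C) (g.map C) (by
      rw [← Matrix.map_mul, hgM]
      exact Matrix.map_one _ C_0 C_1) u _
  have hEuler : ∑ j, linForm (M j) * G j = 0 := by
    have := hpair X
    rw [hF.sum_X_mul_pderiv, nsmul_eq_mul, ← map_natCast (C : k →+* _), hdk, map_zero,
      zero_mul] at this
    exact this
  have hFrob : ∑ j, powForm q (M j) * G j = H * F := by
    rw [← hHF, ← hpair]
    rfl
  have hGhom : ∀ j, (G j).IsHomogeneous (d - 1) := fun j =>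
    IsHomogeneous.sum _ _ _ fun i _ => (isHomogeneous_pderiv hF i).C_mul _
  have hG0 : ∀ P, (∀ j, eval P (G j) = 0) → eval P F = 0 → P = 0 := by
    intro P hP hPF
    by_contra h0
    obtain ⟨i, hi⟩ := hs P h0 hPF
    exact hi (by rw [hGF i, map_sum]; simp [hP])
  set γ : Fin (n + 1) → MvPolynomial (Fin (n + 1)) k := Fin.cons F fun j => G j.succ with hγ
  set e : Fin (n + 1) → ℕ := Fin.cons d fun _ => d - 1 with he
  have hγhom : ∀ i, (γ i).IsHomogeneous (e i) := by
    intro i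
    refine Fin.cases ?_ (fun j => ?_) i
    · simpa [hγ, he] using hF
    · simpa [hγ, he] using hGhom j.succ
  have hepos : ∀ i, 0 < e i := by
    intro i
    refine Fin.cases ?_ (fun j => ?_) i
    · simp [he]; omega
    · simp [he]; omega
  have hγ0 : NoCommonZero γ := by
    intro P hP
    by_contra h0
    have hPF : eval P F = 0 := by simpa [hγ] using hP 0
    refine hc P h0 hPF (eval P (G 0)) fun i => ?_
    rw [hGF i, map_sum, Fin.sum_univ_succ]
    have : ∀ j : Fin n, eval P (G j.succ) = 0 := fun j => by simpa [hγ] using hP j.succ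
    simp [this, mul_comm]
  -- The coefficients left after eliminating `G 0` between `hEuler` and `hFrob`.
  set s : Fin n → MvPolynomial (Fin (n + 1)) k := fun j =>
    linForm (M 0) * powForm q (M j.succ) - powForm q (M 0) * linForm (M j.succ) with hsdef
  have hsum : ∑ j, s j * G j.succ = linForm (M 0) * (H * F) := by
    rw [← hFrob, Fin.sum_univ_succ]
    rw [Fin.sum_univ_succ] at hEuler
    have h1 : ∑ j, s j * G j.succ =
        linForm (M 0) * ∑ j : Fin n, powForm q (M j.succ) * G j.succ -
        powForm q (M 0) * ∑ j : Fin n, linForm (M j.succ) * G j.succ := by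
      rw [Finset.mul_sum, Finset.mul_sum, ← Finset.sum_sub_distrib]
      exact Finset.sum_congr rfl fun j _ => by ring
    rw [h1]
    linear_combination -powForm q (M 0) * hEuler
  have hshom : ∀ j, (s j).IsHomogeneous (q + 1) := fun j => by
    refine IsHomogeneous.sub ?_ ((powForm_isHomogeneous q _).mul (linForm_isHomogeneous _))
    rw [add_comm q 1]
    exact (linForm_isHomogeneous _).mul (powForm_isHomogeneous q _)
  -- Entries of `A` between two derivatives have degree below q + 3 - d, and those between `F` and a
  -- derivative below q + 2 - d.
  obtain ⟨A, hA, hAN, hAs⟩ := (hγ0.isKoszulExact hγhom hepos).exists_truncDegree hγhom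
    (q + d + 1) (Fin.cons (-(H * linForm (M 0))) s)
    (by
      rw [Fin.sum_univ_succ]
      simp only [Fin.cons_zero, Fin.cons_succ, hγ, hsum]
      ring)
    (by
      intro i
      refine Fin.cases ?_ (fun j => ?_) i
      · simp only [Fin.cons_zero, he, map_neg]
        rw [truncDegree_mul (linForm_isHomogeneous _), show q + d + 1 - d - 1 = q by omega, hH]
      · simp only [Fin.cons_succ, he]
        exact truncDegree_of_isHomogeneous (hshom j) (by omega))
  have hs0 : ∀ w : Fin n → k, ∑ j, C (w j) * s j = 0 → w = 0 := fun w hw =>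
    eq_zero_of_linForm_mul_powForm hq hM w hw
  have hle : d ≤ q + 2 := by
    by_contra! hlt
    have hA0 : ∀ i j, A i j = 0 := fun i j => by
      rw [← hAN i j, show q + d + 1 - e i - e j = 0 from ?_, truncDegree_zero_left]
      have h1 : ∀ i, d - 1 ≤ e i := fun i => by
        refine Fin.cases ?_ (fun j => ?_) i <;> simp [he]
      have := h1 i
      have := h1 j
      omega
    have h1 : ∀ j, s j = 0 := fun j => by simpa [hA0] using hAs j.succ
    have h2 := congrFun (hs0 1 (by simp [h1])) ⟨0, by omega⟩
    simp at h2
  refine ⟨hle, ?_⟩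
  rintro rfl
  have hA0 : ∀ j : Fin n, A 0 j.succ = 0 := fun j => by
    rw [← hAN 0 j.succ]
    simp only [he, Fin.cons_zero, Fin.cons_succ]
    rw [show q + (q + 2) + 1 - (q + 2) - (q + 2 - 1) = 0 by omega, truncDegree_zero_left]
  have hA0' : ∀ j : Fin n, A j.succ 0 = 0 := fun j => by rw [hA.apply 0 j.succ, hA0, neg_zero]
  set a : Matrix (Fin n) (Fin n) k := fun i j => coeff 0 (A i.succ j.succ) with ha
  have hAa : ∀ i j : Fin n, A i.succ j.succ = C (a i j) := fun i j => by
    conv_lhs => rw [← hAN i.succ j.succ]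
    simp only [he, Fin.cons_succ]
    rw [show q + (q + 2) + 1 - (q + 2 - 1) - (q + 2 - 1) = 1 by omega, truncDegree_one_left]
  have haalt : IsAlternating a :=
    isAlternating_of_apply (fun i j => by simp [ha, hA.apply i.succ j.succ])
      fun i => by simp [ha, hA.2]
  have hsa : ∀ j, s j = ∑ i, C (a j i) * G i.succ := fun j => by
    have := hAs j.succ
    rw [Fin.sum_univ_succ] at this
    simpa [hγ, hA0', hAa] using this
  have hM0 : linForm (M 0) ≠ 0 := by
    intro h
    obtain ⟨i, hi⟩ := Function.ne_iff.mp hc0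
    have := congrArg (eval (Pi.single i 1)) h
    exact hi (by simpa [Pi.single_apply] using this)
  have hH0 : H = 0 := by
    have := hAs 0
    rw [Fin.sum_univ_succ] at this
    simp only [Fin.cons_zero, hA.2, hA0, zero_mul, Finset.sum_const_zero, add_zero,
      neg_eq_zero, mul_eq_zero, hM0, or_false] at this
    exact this
  have hadet : a.det ≠ 0 := by
    intro h
    obtain ⟨w, hw0, hw⟩ := exists_vecMul_eq_zero_iff.mpr h
    refine hw0 (hs0 w ?_)
    simp only [hsa, Finset.mul_sum]
    rw [Finset.sum_comm]
    refine Finset.sum_eq_zero fun i _ => ?_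
    have h1 : ∑ j, w j * a j i = 0 := congrFun hw i
    rw [← zero_mul (G i.succ), ← C_0, ← h1, map_sum, Finset.sum_mul]
    exact Finset.sum_congr rfl fun j _ => by rw [map_mul]; ring
  have hneven : Even n := by
    rw [← Nat.not_odd_iff_even]
    exact fun h => hadet (haalt.det_eq_zero (by simpa using h))
  set b := a⁻¹ with hb
  have hba : b * a = 1 := nonsing_inv_mul _ (isUnit_iff_ne_zero.mpr hadet)
  have hbalt : IsAlternating b := haalt.inv hadet
  have hGs : ∀ j : Fin n, G j.succ = ∑ i, C (b j i) * s i := by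
    intro j
    have h1 : ∀ l, ∑ i, C (b j i) * (C (a i l) * G l.succ) = C ((b * a) j l) * G l.succ := by
      intro l
      rw [mul_apply, map_sum, Finset.sum_mul]
      exact Finset.sum_congr rfl fun i _ => by rw [map_mul]; ring
    simp only [hsa, Finset.mul_sum]
    rw [Finset.sum_comm]
    simp only [h1, hba, one_apply]
    simp
  -- In Euler's relation the multiple of `powForm q (M 0)` is an alternating quadratic form, hence
  -- zero, and `linForm (M 0)` cancels.
  have hG00 : G 0 = -∑ j, ∑ i, C (b j i) * (linForm (M j.succ) * powForm q (M i.succ)) := by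
    apply mul_left_cancel₀ hM0
    have hquad := (hbalt.mapRingHom (C : k →+* MvPolynomial (Fin (n + 1)) k)).dotProduct_mulVec_self
      fun j => linForm (M j.succ)
    simp only [dotProduct, mulVec, map_apply] at hquad
    rw [Fin.sum_univ_succ] at hEuler
    rw [eq_neg_of_add_eq_zero_left hEuler, mul_neg, neg_inj, Finset.mul_sum]
    have h1 : ∀ j : Fin n, linForm (M j.succ) * G j.succ =
        linForm (M 0) * ∑ i, C (b j i) * (linForm (M j.succ) * powForm q (M i.succ)) -
        powForm q (M 0) * (linForm (M j.succ) * ∑ i, C (b j i) * linForm (M i.succ)) := by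
      intro j
      rw [hGs j]
      simp only [Finset.mul_sum, ← Finset.sum_sub_distrib]
      exact Finset.sum_congr rfl fun i _ => by simp only [hsdef]; ring
    simp only [h1, Finset.sum_sub_distrib, ← Finset.mul_sum (s := Finset.univ)
      (a := powForm q (M 0)), hquad]
    ring
  refine ⟨hH0, ?_, ?_⟩
  · by_contra hn2
    have hn4 : 4 ≤ n := by
      obtain ⟨r, rfl⟩ := hneven
      omega
    -- Four forms in at least five variables, the list being padded by copies of `F`. At a common
    -- zero every `s i`, hence every `G j`, vanishes: a singular point.
    obtain ⟨P, hP0, hP⟩ := exists_common_zero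
      (g := fun i : Fin (n + 1) => if i.1 = 0 then linForm (M 0) else
        if i.1 = 1 then powForm q (M 0) else if i.1 = 2 then G 0 else F)
      (e := fun i : Fin (n + 1) => if i.1 = 0 then 1 else
        if i.1 = 1 then q else if i.1 = 2 then q + 2 - 1 else q + 2)
      (fun i => by
        split_ifs
        · exact linForm_isHomogeneous _
        · exact powForm_isHomogeneous q _
        · exact hGhom 0
        · exact hF)
      (fun i => by
        split_ifs <;> omega)
      (i := ⟨3, by omega⟩) (j := ⟨4, by omega⟩) (by simp) (by simp)
    have h0 : eval P (linForm (M 0)) = 0 := by simpa using hP ⟨0, by omega⟩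
    have h1 : eval P (powForm q (M 0)) = 0 := by simpa using hP ⟨1, by omega⟩
    have h2 : eval P (G 0) = 0 := by simpa using hP ⟨2, by omega⟩
    have h3 : eval P F = 0 := by simpa using hP ⟨3, by omega⟩
    refine hP0 (hG0 P (fun j => Fin.cases h2 (fun j => ?_) j) h3)
    rw [hGs j, map_sum]
    refine Finset.sum_eq_zero fun i _ => ?_
    simp only [hsdef, map_mul, map_sub, h0, h1]
    ring
  · intro i
    rw [hGF i]
    refine sum_mem fun j _ => C_mul_mem _ ?_
    refine Fin.cases ?_ (fun j => ?_) j
    · rw [hG00]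
      exact neg_mem (sum_mem fun j _ => sum_mem fun i _ =>
        C_mul_mem _ (linForm_mul_powForm_mem _ _))
    · rw [hGs j]
      refine sum_mem fun i _ => C_mul_mem _ (sub_mem (linForm_mul_powForm_mem _ _) ?_)
      rw [mul_comm]
      exact linForm_mul_powForm_mem _ _

end Syzygy

/-! ### Descent to the finite field -/

section Descent

variable {K : Type*} [Field K] [Fintype K] {n d : ℕ} {F : MvPolynomial (Fin (n + 1)) K}

theorem F10_isHomogeneous (hF : F.IsHomogeneous d) :
    (F10 F).IsHomogeneous (Fintype.card K + (d - 1)) :=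
  IsHomogeneous.sum _ _ _ fun i _ => (isHomogeneous_X_pow _ _).mul (isHomogeneous_pderiv hF i)

theorem IsFrobeniusNonclassical.exists_quotient (hn : 1 ≤ n) (hd : 1 ≤ d)
    (hF : F.IsHomogeneous d) (hs : IsSmooth F) (hFN : IsFrobeniusNonclassical F) :
    ∃ H, truncDegree (Fintype.card K) H = H ∧ F10 F = H * F := by
  obtain ⟨H, hH⟩ := hFN.dvd_F10 hn hs
  rw [mul_comm] at hH
  refine ⟨H, mul_right_cancel₀ hs.ne_zero ?_, hH⟩
  rw [← hH, ← truncDegree_of_isHomogeneous (F10_isHomogeneous hF)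
    (show _ < Fintype.card K + d by omega), hH, truncDegree_mul hF, Nat.add_sub_cancel]

theorem exists_of_mem_frobeniusSpan {k σ : Type*} [Field k] {q : ℕ} {f : MvPolynomial σ k}
    (hf : f ∈ frobeniusSpan k σ q) {m : σ →₀ ℕ} (hm : coeff m f ≠ 0) :
    ∃ a b, m = Finsupp.single a 1 + Finsupp.single b q := by
  classical
  by_contra! hno
  refine hm ?_
  induction hf using Submodule.span_induction with
  | mem f hf =>
    obtain ⟨⟨a, b⟩, rfl⟩ := hf
    have : (X a * X b ^ q : MvPolynomial σ k) =
        monomial (Finsupp.single a 1 + Finsupp.single b q) 1 := by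
      rw [X_pow_eq_monomial, X, monomial_mul, one_mul]
    simp only [this, coeff_monomial]
    exact if_neg (hno a b).symm
  | zero => simp
  | add f g _ _ hf hg =>
    by_cases h : coeff m f = 0
    · by_cases h' : coeff m g = 0
      · simp [h, h']
      · exact absurd (hg h') h'
    · exact absurd (hf h) h
  | smul r f _ hf =>
    by_cases h : coeff m f = 0
    · simp [h]
    · exact absurd (hf h) h

theorem IsFrobeniusNonclassical.degree_le (hn : 2 ≤ n) (hd : 2 ≤ d)
    (hF : F.IsHomogeneous d) (hs : IsSmooth F) (hFN : IsFrobeniusNonclassical F)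
    (hdK : (d : K) = 0) :
    d ≤ Fintype.card K + 2 ∧ (d = Fintype.card K + 2 → F10 F = 0 ∧ n = 2 ∧
      ∀ i m, coeff m (pderiv i F) ≠ 0 →
        ∃ a b, m = Finsupp.single a 1 + Finsupp.single b (Fintype.card K)) := by
  obtain ⟨H, hHt, hH⟩ := hFN.exists_quotient (by omega) (by omega) hF hs
  set φ := algebraMap K (AlgebraicClosure K)
  have hcard : 2 ≤ Fintype.card K := Fintype.one_lt_card
  have hφ : ∀ (P : Fin (n + 1) → AlgebraicClosure K) f, eval P (map φ f) = aeval P f :=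
    fun P f => by rw [aeval_def, eval_map]
  obtain ⟨h1, h2⟩ := degree_le_of_cast_eq_zero (F := map φ F) hn hcard hd (hF.map φ)
    ((map_ne_zero_iff _ (map_injective φ φ.injective)).mpr hs.ne_zero)
    (fun P hP0 hP => by
      obtain ⟨i, hi⟩ := hs P ⟨hP0, by rw [← hφ]; exact hP⟩
      exact ⟨i, by rwa [pderiv_map, hφ]⟩)
    (by rw [← map_natCast φ, hdK, map_zero])
    (map φ H) (by rw [truncDegree_map, hHt])
    (by
      have := congrArg (map φ) hH
      simpa [F10, pderiv_map] using this)
  refine ⟨h1, fun hdq => ?_⟩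
  obtain ⟨h3, h4, h5⟩ := h2 hdq
  refine ⟨?_, h4, fun i m hm => ?_⟩
  · rw [hH, (map_eq_zero_iff _ (map_injective φ φ.injective)).mp h3, zero_mul]
  · refine exists_of_mem_frobeniusSpan (h5 i) (m := m) ?_
    rw [pderiv_map, coeff_map]
    exact (map_ne_zero φ).mpr hm

end Descent

/-! ### The ternary form in characteristic two -/

section Ternary

variable {K : Type*} [Field K]

/-- The exponent of `x_0 x_1 x_2 x_k ^ (q - 1)`. -/
noncomputable def ternaryExponent (q : ℕ) (k : Fin 3) : Fin 3 →₀ ℕ :=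
  Finsupp.equivFunOnFinite.symm fun x => if x = k then q else 1

@[simp]
theorem ternaryExponent_apply (q : ℕ) (k x : Fin 3) :
    ternaryExponent q k x = if x = k then q else 1 := rfl

theorem ternaryExponent_injective {q : ℕ} (hq : 2 ≤ q) :
    Function.Injective (ternaryExponent q) := by
  intro k l h
  by_contra hkl
  have := DFunLike.congr_fun h k
  simp [hkl] at this
  omega

theorem sum_monomial_ternaryExponent {q : ℕ} (hq : 2 ≤ q) :
    (X 0 * X 1 * X 2 * (X 0 ^ (q - 1) + X 1 ^ (q - 1) + X 2 ^ (q - 1)) :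
      MvPolynomial (Fin 3) K) = ∑ k, monomial (ternaryExponent q k) 1 := by
  obtain ⟨r, rfl⟩ : ∃ r, q = r + 1 := ⟨q - 1, by omega⟩
  simp only [monomial_eq, Fin.sum_univ_three, Finsupp.prod_fintype _ _ (fun _ => pow_zero _),
    Fin.prod_univ_three, ternaryExponent_apply, map_one, Nat.add_sub_cancel]
  simp
  ring

theorem exists_aeval_sq_eq {σ : Type*} [Finite σ] {E : MvPolynomial σ K}
    (hE : ∀ m, coeff m E ≠ 0 → ∀ i, Even (m i)) :
    ∃ G : MvPolynomial σ K, aeval (fun i => (X i : MvPolynomial σ K) ^ 2) G = E := by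
  cases nonempty_fintype σ
  refine ⟨∑ m ∈ E.support, monomial (m.mapRange (· / 2) rfl) (coeff m E), ?_⟩
  conv_rhs => rw [E.as_sum]
  rw [map_sum]
  refine Finset.sum_congr rfl fun m hm => ?_
  rw [aeval_monomial, monomial_eq, algebraMap_eq,
    Finsupp.prod_fintype _ _ (fun _ => pow_zero _), Finsupp.prod_fintype _ _ (fun _ => pow_zero _)]
  congr 1
  refine Finset.prod_congr rfl fun i _ => ?_
  rw [Finsupp.mapRange_apply, ← pow_mul, Nat.two_mul_div_two_of_even
    (hE m (mem_support_iff.mp hm) i)]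

theorem coeff_sum_monomial_ternaryExponent {q : ℕ} (hq : 2 ≤ q) (m : Fin 3 →₀ ℕ)
    [Decidable (∃ k, m = ternaryExponent q k)] :
    coeff m (∑ k, monomial (ternaryExponent q k) (1 : K)) =
      if ∃ k, m = ternaryExponent q k then 1 else 0 := by
  classical
  simp only [coeff_sum, coeff_monomial]
  split_ifs with h
  · obtain ⟨k, rfl⟩ := h
    simp [(ternaryExponent_injective hq).eq_iff]
  · push Not at h
    exact Finset.sum_eq_zero fun k _ => if_neg (h k).symm

theorem HasTernaryForm.degree_eq [Fintype K] {F : MvPolynomial (Fin 3) K} (hF : HasTernaryForm F)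
    {d : ℕ} (hd : F.IsHomogeneous d) : d = Fintype.card K + 2 := by
  classical
  have hq2 : 2 ≤ Fintype.card K := Fintype.one_lt_card
  obtain ⟨G, hG⟩ := hF
  have h1 : coeff (ternaryExponent (Fintype.card K) 0)
      (aeval (fun i => (X i : MvPolynomial (Fin 3) K) ^ 2) G) = 0 :=
    coeff_expand_of_not_dvd (p := 2) G (i := 1) (by simp)
  have h2 : coeff (ternaryExponent (Fintype.card K) 0) F ≠ 0 := by
    rw [hG, sum_monomial_ternaryExponent hq2, coeff_add, coeff_sum_monomial_ternaryExponent hq2,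
      h1, if_pos ⟨0, rfl⟩, add_zero]
    exact one_ne_zero
  by_contra hne
  refine h2 (hd.coeff_eq_zero fun h => hne ?_)
  rw [← h, Finsupp.degree_eq_sum]
  simp [Fin.sum_univ_three]

variable [CharP K 2]

theorem coeff_pderiv_of_even {σ : Type*} {f : MvPolynomial σ K} {i : σ} {m : σ →₀ ℕ}
    (hm : Even (m i)) : coeff m (pderiv i f) = coeff (m + Finsupp.single i 1) f := by
  rw [coeff_pderiv, (CharP.cast_eq_zero_iff K 2 (m i)).mpr hm.two_dvd, zero_add, mul_one]

variable [Fintype K] {F : MvPolynomial (Fin 3) K}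

theorem even_card : Even (Fintype.card K) := by
  rw [even_iff_two_dvd, ← CharP.cast_eq_zero_iff K 2, FiniteField.cast_card_eq_zero]

/-- An odd exponent of x_i survives in F_i, so the monomial is x_i x_a x_b^q. Parity excludes a = i;
`hpure`, for F_i and F_a, excludes a = b and b = i. -/
theorem eq_ternaryExponent
    (hsupp : ∀ i m, coeff m (pderiv i F) ≠ 0 →
      ∃ a b, m = Finsupp.single a 1 + Finsupp.single b (Fintype.card K))
    (hpure : ∀ i a, coeff (Finsupp.single a (Fintype.card K + 1)) (pderiv i F) = 0)
    {m : Fin 3 →₀ ℕ} (hm : coeff m F ≠ 0) {i : Fin 3} (hi : Odd (m i)) :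
    ∃ k, m = ternaryExponent (Fintype.card K) k := by
  have hq : Even (Fintype.card K) := even_card
  obtain ⟨r, hr⟩ := hi
  obtain ⟨m', rfl⟩ : ∃ m', m = m' + Finsupp.single i 1 :=
    ⟨m - Finsupp.single i 1, (tsub_add_cancel_of_le (by simp; omega)).symm⟩
  have hm'i : m' i = 2 * r := by simpa using hr
  rw [← coeff_pderiv_of_even ⟨r, by omega⟩] at hm
  obtain ⟨a, b, rfl⟩ := hsupp i m' hm
  have hab : a ≠ b := by
    rintro rfl
    rw [← Finsupp.single_add, add_comm] at hm
    exact hm (hpure i a)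
  have hai : a ≠ i := by
    rintro rfl
    simp [Ne.symm hab] at hm'i
    omega
  have hbi : b ≠ i := by
    rintro rfl
    rw [coeff_pderiv_of_even (by simp [Ne.symm hai, hq])] at hm
    have h1 := hpure a b
    rw [coeff_pderiv_of_even (by simp [hab])] at h1
    refine hm (Eq.trans ?_ h1)
    congr 1
    rw [Finsupp.single_add]
    abel
  refine ⟨b, ?_⟩
  ext x
  simp only [Finsupp.add_apply, Finsupp.single_apply, ternaryExponent_apply]
  by_cases hx : x = b
  · subst hx
    simp [hab, Ne.symm hbi]
  · by_cases hxa : x = a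
    · subst hxa
      simp [hx, Ne.symm hx, Ne.symm hai]
    · have hxi : x = i := by omega
      subst hxi
      simp [hx, Ne.symm hx, Ne.symm hxa]

/-- Compare the coefficients of x_a^q x_b^q x_r in F_{1,0}; the term x_r^q F_r does not contribute.
-/
theorem coeff_ternaryExponent_eq (h10 : F10 F = 0) {a b r : Fin 3} (hab : a ≠ b) (har : a ≠ r)
    (hbr : b ≠ r) : coeff (ternaryExponent (Fintype.card K) a) F =
      coeff (ternaryExponent (Fintype.card K) b) F := by
  have hq2 : 2 ≤ Fintype.card K := Fintype.one_lt_card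
  let M : Fin 3 →₀ ℕ := Finsupp.equivFunOnFinite.symm
    fun x => if x = r then 1 else Fintype.card K
  have hM : ∀ x, M x = if x = r then 1 else Fintype.card K := fun _ => rfl
  have huniv : (Finset.univ : Finset (Fin 3)) = {a, b, r} := by
    ext x; simp; omega
  have key : ∀ a b : Fin 3, a ≠ b → a ≠ r → b ≠ r →
      coeff M (X a ^ Fintype.card K * pderiv a F) =
        coeff (ternaryExponent (Fintype.card K) b) F := by
    intro a b hab har hbr
    rw [X_pow_eq_monomial, coeff_monomial_mul', if_pos (by simp [hM, har]), one_mul, coeff_pderiv_of_even (by simp [hM, har])]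
    congr 1
    ext x
    simp only [Finsupp.add_apply, Finsupp.tsub_apply, Finsupp.single_apply, hM,
      ternaryExponent_apply]
    by_cases hxa : x = a
    · subst hxa; simp [hab, har]
    · by_cases hxb : x = b
      · subst hxb; simp [hab, hbr]
      · have : x = r := by omega
        subst this; simp [har, hxb]
  have h1 := congrArg (coeff M) h10
  rw [F10, huniv, Finset.sum_insert (by simp [hab, har]), Finset.sum_insert (by simp [hbr]),
    Finset.sum_singleton, coeff_add, coeff_add, key a b hab har hbr, key b a hab.symm hbr har,
    X_pow_eq_monomial,
    coeff_monomial_mul', if_neg (by simp [hM]; omega), add_zero, coeff_zero,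
    CharTwo.add_eq_zero] at h1
  exact h1.symm

theorem exists_hasTernaryForm
    (hsupp : ∀ i m, coeff m (pderiv i F) ≠ 0 →
      ∃ a b, m = Finsupp.single a 1 + Finsupp.single b (Fintype.card K))
    (hpure : ∀ i a, coeff (Finsupp.single a (Fintype.card K + 1)) (pderiv i F) = 0)
    (h10 : F10 F = 0) (hne : ∃ i, pderiv i F ≠ 0) :
    ∃ c : K, c ≠ 0 ∧ HasTernaryForm (C c * F) := by
  classical
  have hq2 : 2 ≤ Fintype.card K := Fintype.one_lt_card
  set q := Fintype.card K with hq
  set c := coeff (ternaryExponent q 0) F with hc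
  have hck : ∀ k, coeff (ternaryExponent q k) F = c := by
    intro k
    fin_cases k
    · rfl
    · exact coeff_ternaryExponent_eq h10 (a := 1) (b := 0) (r := 2) (by decide) (by decide)
        (by decide)
    · exact coeff_ternaryExponent_eq h10 (a := 2) (b := 0) (r := 1) (by decide) (by decide)
        (by decide)
  -- In characteristic 2 the derivatives see only odd exponents, and all such monomials have
  -- coefficient `c`.
  have hc0 : c ≠ 0 := by
    intro h0
    obtain ⟨i, hi⟩ := hne
    refine hi ?_
    ext m
    rw [coeff_zero]
    rcases Nat.even_or_odd (m i) with hm | hm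
    · rw [coeff_pderiv_of_even hm]
      by_contra hne
      obtain ⟨k, hk⟩ := eq_ternaryExponent hsupp hpure hne (i := i) (by simpa using hm.add_one)
      exact hne (by rw [hk, hck, h0])
    · rw [coeff_pderiv]
      have := (CharP.cast_eq_zero_iff K 2 (m i + 1)).mpr hm.add_one.two_dvd
      push_cast at this
      rw [this, mul_zero]
  refine ⟨c⁻¹, inv_ne_zero hc0, ?_⟩
  obtain ⟨G, hG⟩ := exists_aeval_sq_eq
    (E := C c⁻¹ * F - ∑ k, monomial (ternaryExponent q k) (1 : K)) (by
      intro m hm i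
      by_contra hodd
      rw [Nat.not_even_iff_odd] at hodd
      apply hm
      rw [coeff_sub, coeff_C_mul, coeff_sum_monomial_ternaryExponent hq2]
      split_ifs with h
      · obtain ⟨k, rfl⟩ := h
        rw [hck, inv_mul_cancel₀ hc0, sub_self]
      · by_cases h' : coeff m F = 0
        · rw [h', mul_zero, sub_zero]
        · exact absurd (eq_ternaryExponent hsupp hpure h' hodd) h)
  refine ⟨G, ?_⟩
  rw [hG, sum_monomial_ternaryExponent hq2]
  ring

end Ternary

/-! ### Second derivatives and the chain rule -/

section Derivative

variable {R σ τ : Type*} [CommRing R]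

theorem pderiv_comm (i j : σ) (f : MvPolynomial σ R) :
    pderiv i (pderiv j f) = pderiv j (pderiv i f) := by
  classical
  have hX : ∀ i j l : σ, pderiv i (pderiv j (X l : MvPolynomial σ R)) = 0 := fun i j l => by
    rw [pderiv_X, Pi.single_apply]
    split_ifs <;> simp
  induction f using MvPolynomial.induction_on with
  | C a => simp
  | add f g hf hg => simp only [map_add, hf, hg]
  | mul_X f l hf =>
    simp only [pderiv_mul, map_add, hX, hf]
    ring

theorem pderiv_self_self_of_two_eq_zero (h2 : (2 : R) = 0) (i : σ) (f : MvPolynomial σ R) :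
    pderiv i (pderiv i f) = 0 := by
  ext m
  rw [coeff_pderiv, coeff_pderiv, mul_assoc, coeff_zero]
  obtain ⟨r, hr⟩ := Nat.even_mul_succ_self (m i + 1)
  have h1 : (((m i + 1) * (m i + 1).succ : ℕ) : R) = 0 := by
    rw [hr, ← two_mul, Nat.cast_mul, Nat.cast_ofNat, h2, zero_mul]
  have h3 : (((m + Finsupp.single i 1 : σ →₀ ℕ) i : ℕ) + 1 : R) * ((m i : R) + 1) = 0 := by
    rw [← h1]
    simp only [Finsupp.add_apply, Finsupp.single_eq_same]
    push_cast
    ring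
  rw [h3, mul_zero]

theorem pderiv_aeval [Fintype σ] (u : σ → MvPolynomial τ R) (j : τ) (f : MvPolynomial σ R) :
    pderiv j (aeval u f) = ∑ i, aeval u (pderiv i f) * pderiv j (u i) := by
  classical
  induction f using MvPolynomial.induction_on with
  | C a => simp
  | add f g hf hg => simp only [map_add, hf, hg, add_mul, Finset.sum_add_distrib]
  | mul_X f l hf =>
    have h1 : ∑ i, aeval u f * aeval u (pderiv i (X l : MvPolynomial σ R)) *
        pderiv j (u i) =
        aeval u f * pderiv j (u l) := by
      rw [Finset.sum_eq_single l]
      · simp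
      · intro i _ hi
        rw [pderiv_X_of_ne hi.symm, map_zero, mul_zero, zero_mul]
      · simp
    simp only [map_mul, aeval_X, pderiv_mul, map_add, hf, add_mul, Finset.sum_add_distrib, h1,
      Finset.sum_mul]
    refine congrArg (· + _) (Finset.sum_congr rfl fun i _ => ?_)
    exact mul_right_comm _ _ _

end Derivative

/-! ### Normal forms in degree q + 1 -/

section NormalForm

open Matrix

variable {K : Type*} [Field K] {n : ℕ} {F : MvPolynomial (Fin (n + 1)) K}

theorem isNondegSkew_iff {m : ℕ} {A : Matrix (Fin m) (Fin m) K} :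
    IsNondegSkew A ↔ IsAlternating A ∧ A.det ≠ 0 :=
  and_assoc.symm

theorem sum_X_mul_pderiv_of_card [Fintype K] (hF : F.IsHomogeneous (Fintype.card K + 1)) :
    ∑ i, X i * pderiv i F = F := by
  rw [hF.sum_X_mul_pderiv, nsmul_eq_mul, ← map_natCast (C : K →+* _)]
  simp

theorem sum_mul_C_mul_self {m : ℕ} {σ : Type*} {A : Matrix (Fin m) (Fin m) K}
    (hA : IsAlternating A) (u : Fin m → MvPolynomial σ K) :
    ∑ i, u i * ∑ j, C (A i j) * u j = 0 :=
  (hA.mapRingHom (C : K →+* MvPolynomial σ K)).dotProduct_mulVec_self u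

theorem sum_inv_mul {m : ℕ} {σ : Type*} {A : Matrix (Fin m) (Fin m) K} (hA : A.det ≠ 0)
    {u s : Fin m → MvPolynomial σ K} (h : ∀ i, s i = ∑ j, C (A i j) * u j) (j : Fin m) :
    u j = ∑ i, C (A⁻¹ j i) * s i := by
  have h1 : s = A.map C *ᵥ u := funext h
  have h2 : A⁻¹.map C *ᵥ s = u := by
    rw [h1, mulVec_mulVec, ← Matrix.map_mul, nonsing_inv_mul _ (isUnit_iff_ne_zero.mpr hA),
      Matrix.map_one _ C_0 C_1, one_mulVec]
  exact (congrFun h2 j).symm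

theorem isNondegSkew_inv_transpose {m : ℕ} {A : Matrix (Fin m) (Fin m) K} (hA : IsAlternating A)
    (hdet : A.det ≠ 0) : IsNondegSkew A⁻¹ᵀ := by
  rw [isNondegSkew_iff]
  refine ⟨isAlternating_of_apply (fun i j => (hA.inv hdet).apply j i)
    fun i => (hA.inv hdet).2 i, ?_⟩
  rw [det_transpose]
  exact (isUnit_nonsing_inv_det _ (isUnit_iff_ne_zero.mpr hdet)).ne_zero

variable {A : Matrix (Fin (n + 1)) (Fin (n + 1)) K} {H : MvPolynomial (Fin (n + 1)) K}

/-- Insert F_j = ∑ (A⁻¹)_ji (x_i^q - H x_i) in Euler's formula; the `H` terms cancel because A⁻¹ is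
alternating. -/
theorem hasSkewForm_of_det_ne_zero [Fintype K] (hF : F.IsHomogeneous (Fintype.card K + 1))
    (hA : IsAlternating A) (hdet : A.det ≠ 0)
    (h : ∀ i, X i ^ Fintype.card K - H * X i = ∑ j, C (A i j) * pderiv j F) :
    HasSkewForm F := by
  refine ⟨A⁻¹ᵀ, isNondegSkew_inv_transpose hA hdet, ?_⟩
  have hquad := sum_mul_C_mul_self (hA.inv hdet) (X : Fin (n + 1) → MvPolynomial (Fin (n + 1)) K)
  rw [Finset.sum_comm]
  conv_lhs => rw [← sum_X_mul_pderiv_of_card hF]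
  rw [← sub_zero (∑ i, ∑ j, _), ← mul_zero H, ← hquad, Finset.mul_sum, ← Finset.sum_sub_distrib]
  refine Finset.sum_congr rfl fun j _ => ?_
  rw [sum_inv_mul hdet h j, Finset.mul_sum, Finset.mul_sum, Finset.mul_sum,
    ← Finset.sum_sub_distrib]
  exact Finset.sum_congr rfl fun i _ => by rw [transpose_apply]; ring

theorem sum_C_mul_eq_zero_of_vecMul (v : Fin (n + 1) → K) (hv : v ᵥ* A = 0)
    (f : Fin (n + 1) → MvPolynomial (Fin (n + 1)) K) :
    ∑ i, C (v i) * ∑ j, C (A i j) * f j = 0 := by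
  simp only [Finset.mul_sum]
  rw [Finset.sum_comm]
  refine Finset.sum_eq_zero fun j _ => ?_
  have h1 : ∑ i, v i * A i j = 0 := congrFun hv j
  rw [← zero_mul (f j), ← C_0, ← h1, map_sum, Finset.sum_mul]
  exact Finset.sum_congr rfl fun i _ => by rw [map_mul]; ring

theorem powForm_eq_of_vecMul {q : ℕ} {f : Fin (n + 1) → MvPolynomial (Fin (n + 1)) K}
    (h : ∀ i, X i ^ q - H * X i = ∑ j, C (A i j) * f j)
    {v : Fin (n + 1) → K} (hv : v ᵥ* A = 0) : powForm q v = H * linForm v := by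
  have h1 := sum_C_mul_eq_zero_of_vecMul v hv f
  rw [← sub_eq_zero, ← h1, powForm, linForm, Finset.mul_sum, ← Finset.sum_sub_distrib]
  exact Finset.sum_congr rfl fun i _ => by rw [← h]; ring

theorem det_ne_zero_of_odd {q : ℕ} (hq : 2 ≤ q)
    {f : Fin (n + 1) → MvPolynomial (Fin (n + 1)) K} (hA : IsAlternating A) (hn : Odd n)
    (h : ∀ i, X i ^ q - H * X i = ∑ j, C (A i j) * f j) : A.det ≠ 0 := by
  intro hdet
  obtain ⟨v, w, hv, hw, i, j, hij⟩ := hA.exists_vecMul_eq_zero_pair hn hdet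
  refine hij (linForm_mul_powForm_comm hq ?_ i j)
  rw [powForm_eq_of_vecMul h hv, powForm_eq_of_vecMul h hw]
  ring

/-- The block of `A` away from 0 has an inverse b, and F_jk = -b_jk x_0^(q-1). So b is both
symmetric and alternating; being nonzero, it forces characteristic 2. -/
theorem hasPartialSkewForm_of_row_eq_zero [Fintype K] (hn : 2 ≤ n)
    (hF : F.IsHomogeneous (Fintype.card K + 1)) (hA : IsAlternating A) (hA0 : ∀ j, A 0 j = 0)
    (h : ∀ i, X i ^ Fintype.card K - X 0 ^ (Fintype.card K - 1) * X i =
      ∑ j, C (A i j) * pderiv j F) :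
    (2 : K) = 0 ∧ HasPartialSkewForm F := by
  have hq2 : 2 ≤ Fintype.card K := Fintype.one_lt_card
  set q := Fintype.card K with hq
  have hA0' : ∀ i, A i 0 = 0 := fun i => by rw [hA.apply 0 i, hA0, neg_zero]
  set a := A.submatrix Fin.succ Fin.succ with ha
  have haalt : IsAlternating a := hA.submatrix _
  have hs : ∀ i : Fin n, X i.succ ^ q - X 0 ^ (q - 1) * X i.succ =
      ∑ j, C (a i j) * pderiv j.succ F := fun i => by
    rw [h, Fin.sum_univ_succ, hA0', C_0, zero_mul, zero_add]
    rfl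
  have hdet : a.det ≠ 0 := by
    intro hdet
    obtain ⟨w, hw0, hw⟩ := exists_vecMul_eq_zero_iff.mpr hdet
    have h1 : ∑ i : Fin n, C (w i) * (X i.succ ^ q - X 0 ^ (q - 1) * X i.succ) =
        (0 : MvPolynomial (Fin (n + 1)) K) := by
      simp only [hs, Finset.mul_sum]
      rw [Finset.sum_comm]
      refine Finset.sum_eq_zero fun j _ => ?_
      have h1 : ∑ i, w i * a i j = 0 := congrFun hw j
      rw [← zero_mul (pderiv j.succ F), ← C_0, ← h1, map_sum, Finset.sum_mul]
      exact Finset.sum_congr rfl fun i _ => by rw [map_mul]; ring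
    refine hw0 (funext fun i => ?_)
    have h2 := congrArg (eval (Pi.single i.succ 1)) h1
    simpa [Pi.single_apply, ite_pow, show q ≠ 0 by omega, show q - 1 ≠ 0 by omega,
      (Fin.succ_ne_zero i).symm] using h2
  set b := a⁻¹ with hb
  have hbalt : IsAlternating b := haalt.inv hdet
  have hFs : ∀ j : Fin n, pderiv j.succ F =
      ∑ i, C (b j i) * (X i.succ ^ q - X 0 ^ (q - 1) * X i.succ) := fun j =>
    sum_inv_mul hdet hs j
  have hder : ∀ j k : Fin n, pderiv k.succ (pderiv j.succ F) = -(C (b j k) * X 0 ^ (q - 1)) := by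
    intro j k
    have hX : ∀ i : Fin n, pderiv k.succ
        (X i.succ ^ q - X 0 ^ (q - 1) * X i.succ : MvPolynomial (Fin (n + 1)) K) =
        if i = k then -X 0 ^ (q - 1) else 0 := by
      intro i
      have e1 : pderiv k.succ (X i.succ ^ q : MvPolynomial (Fin (n + 1)) K) = 0 := by
        have := pderiv_X_pow_card_mul k.succ i.succ (1 : MvPolynomial (Fin (n + 1)) K)
        simpa using this
      have e2 : pderiv k.succ (X 0 ^ (q - 1) : MvPolynomial (Fin (n + 1)) K) = 0 := by
        rw [pderiv_pow, pderiv_X_of_ne (Fin.succ_ne_zero k).symm, mul_zero]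
      rw [map_sub, e1, pderiv_mul, e2, pderiv_X, Pi.single_apply]
      by_cases hik : i = k
      · simp [hik]
      · simp [hik]
    rw [hFs j, map_sum]
    simp only [pderiv_C_mul, hX]
    simp
  have hsymm : ∀ j k, b j k = b k j := by
    intro j k
    have h1 := pderiv_comm k.succ j.succ F
    rw [hder, hder, neg_inj] at h1
    exact C_injective _ _ (mul_right_cancel₀ (pow_ne_zero _ (X_ne_zero _)) h1)
  have h2 : (2 : K) = 0 := by
    by_contra h2
    have hb0 : b = 0 := by
      ext j k
      have h3 : b j k = -b j k := by
        conv_lhs => rw [hsymm, hbalt.apply]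
      have h4 : 2 * b j k = 0 := by linear_combination h3
      exact (mul_eq_zero.mp h4).resolve_left h2
    have h5 := nonsing_inv_mul a (isUnit_iff_ne_zero.mpr hdet)
    rw [← hb, hb0, Matrix.zero_mul] at h5
    have := congrFun (congrFun h5 ⟨0, by omega⟩) ⟨0, by omega⟩
    simp at this
  -- Euler's formula isolates the `X 0` term with `G = pderiv 0 F`, killed by a second `pderiv 0` in
  -- characteristic 2.
  refine ⟨h2, ?_, pderiv 0 F, b.transpose, pderiv_self_self_of_two_eq_zero h2 0 F,
    isNondegSkew_inv_transpose haalt hdet, ?_⟩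
  · have hquad := sum_mul_C_mul_self hA fun i => pderiv i F
    have e : X 0 ^ (q - 1) * F = ∑ i, X 0 ^ (q - 1) * (X i * pderiv i F) := by
      rw [← Finset.mul_sum, sum_X_mul_pderiv_of_card hF]
    rw [F10, ← hq, ← sub_eq_zero, ← hquad, e, ← Finset.sum_sub_distrib]
    exact Finset.sum_congr rfl fun i _ => by rw [← h]; ring
  · have hquad := sum_mul_C_mul_self hbalt
      fun i => (X i.succ : MvPolynomial (Fin (n + 1)) K)
    conv_lhs => rw [← sum_X_mul_pderiv_of_card hF, Fin.sum_univ_succ]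
    congr 1
    rw [Finset.sum_comm, ← sub_zero (∑ i, ∑ j, _), ← mul_zero (X 0 ^ (q - 1)), ← hquad,
      Finset.mul_sum, ← Finset.sum_sub_distrib]
    refine Finset.sum_congr rfl fun j _ => ?_
    rw [hFs j, Finset.mul_sum, Finset.mul_sum, Finset.mul_sum, ← Finset.sum_sub_distrib]
    exact Finset.sum_congr rfl fun i _ => by rw [transpose_apply]; ring

end NormalForm

/-! ### Moving a kernel vector to the first coordinate -/

section LinearSubst

open Matrix

variable {K : Type*} [Field K] {n : ℕ} {F : MvPolynomial (Fin (n + 1)) K}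

theorem linearSubst_isHomogeneous {d : ℕ} (hF : F.IsHomogeneous d)
    (g : GeneralLinearGroup (Fin (n + 1)) K) : (linearSubst g F).IsHomogeneous d := by
  have := hF.aeval (fun i => ∑ j, C (g.val i j) * (X j : MvPolynomial (Fin (n + 1)) K))
    (n := 1) fun i => IsHomogeneous.sum _ _ _ fun _ _ => isHomogeneous_C_mul_X _ _
  rwa [one_mul] at this

variable [Fintype K]

theorem linForm_pow_card {σ : Type*} [Fintype σ] (c : σ → K) :
    linForm c ^ Fintype.card K = powForm (Fintype.card K) c := by
  obtain ⟨p, hp⟩ := CharP.exists K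
  obtain ⟨m, hprime, hcard⟩ := FiniteField.card K p
  have : Fact p.Prime := ⟨hprime⟩
  rw [linForm, powForm]
  conv_lhs => rw [hcard, sum_pow_char_pow]
  refine Finset.sum_congr rfl fun j _ => ?_
  rw [← hcard, mul_pow, ← C_pow, FiniteField.pow_card]

/-- If `M` has a kernel vector as first row, substituting `M⁻¹` replaces `A` by `M A Mᵀ`, with zero
first row. Coefficients in `K` are fixed by Frobenius, so the x_i^q transform like the x_i, and the
first row reads x_0^q = H x_0. -/
theorem exists_hasPartialSkewForm (hn : 2 ≤ n)
    {A : Matrix (Fin (n + 1)) (Fin (n + 1)) K} {H : MvPolynomial (Fin (n + 1)) K}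
    (hF : F.IsHomogeneous (Fintype.card K + 1)) (hA : IsAlternating A) (hdet : A.det = 0)
    (h : ∀ i, X i ^ Fintype.card K - H * X i = ∑ j, C (A i j) * pderiv j F) :
    (2 : K) = 0 ∧ ∃ g, HasPartialSkewForm (linearSubst g F) := by
  have hq2 : 2 ≤ Fintype.card K := Fintype.one_lt_card
  obtain ⟨v, hv0, hv⟩ := exists_vecMul_eq_zero_iff.mpr hdet
  obtain ⟨M, hM, rfl⟩ := exists_isUnit_det_row hv0
  have hMu : IsUnit M.det := isUnit_iff_ne_zero.mpr hM
  let g : GeneralLinearGroup (Fin (n + 1)) K :=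
    GeneralLinearGroup.mkOfDetNeZero M⁻¹ (isUnit_nonsing_inv_det _ hMu).ne_zero
  have hg : g.val = M⁻¹ := rfl
  let u : Fin (n + 1) → MvPolynomial (Fin (n + 1)) K := fun i => linForm (g.val i)
  have hsub : ∀ f, linearSubst g f = aeval u f := fun f => rfl
  set F' := linearSubst g F with hF'
  have hgrad : (fun l => pderiv l F') = (g.val.map C)ᵀ *ᵥ fun i => aeval u (pderiv i F) := by
    ext1 l
    rw [hF', hsub, pderiv_aeval]
    refine Finset.sum_congr rfl fun i _ => ?_
    rw [mul_comm]
    congr 1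
    simp [u, linForm, pderiv_X, Pi.single_apply]
  have hMg : M.map C * g.val.map C = (1 : Matrix _ _ (MvPolynomial (Fin (n + 1)) K)) := by
    rw [← Matrix.map_mul, hg, mul_nonsing_inv _ hMu, Matrix.map_one _ C_0 C_1]
  have hgM : g.val.map C * M.map C = (1 : Matrix _ _ (MvPolynomial (Fin (n + 1)) K)) := by
    rw [← Matrix.map_mul, hg, nonsing_inv_mul _ hMu, Matrix.map_one _ C_0 C_1]
  have hgrad' : (fun i => aeval u (pderiv i F)) = (M.map C)ᵀ *ᵥ fun l => pderiv l F' := by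
    rw [hgrad, mulVec_mulVec, ← transpose_mul, hgM, transpose_one, one_mulVec]
  have hrel : (g.val.map C *ᵥ fun j => X j ^ Fintype.card K) -
      aeval u H • (g.val.map C *ᵥ X) = A.map C *ᵥ fun i => aeval u (pderiv i F) := by
    ext1 i
    have := congrArg (aeval u) (h i)
    simp only [map_sub, map_mul, map_pow, aeval_X, map_sum] at this
    rw [show u i = linForm (g.val i) from rfl, linForm_pow_card] at this
    have hC : ∀ a, aeval u (C a : MvPolynomial (Fin (n + 1)) K) = C a := fun a => aeval_C u a
    simp only [hC] at this
    exact this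
  have hrel' := congrArg (M.map C *ᵥ ·) hrel
  simp only [mulVec_sub, mulVec_smul, mulVec_mulVec, hMg, one_mulVec, hgrad'] at hrel'
  have hmat : M.map C * (A.map C * (M.map C)ᵀ) =
      (Mᵀᵀ * A * Mᵀ).map (C : K →+* MvPolynomial (Fin (n + 1)) K) := by
    rw [Matrix.map_mul, Matrix.map_mul, transpose_transpose, Matrix.mul_assoc, transpose_map]
  rw [hmat] at hrel'
  have hA' := hA.conj Mᵀ
  have hA0 : ∀ j, (Mᵀᵀ * A * Mᵀ) 0 j = 0 := by
    intro j
    rw [transpose_transpose, mul_apply]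
    refine Finset.sum_eq_zero fun l _ => ?_
    have : (M * A) 0 l = 0 := congrFun hv l
    rw [this, zero_mul]
  have hrel0 := congrFun hrel' 0
  have hH : aeval u H = X 0 ^ (Fintype.card K - 1) := by
    simp only [mulVec, dotProduct, map_apply, hA0, Pi.sub_apply, Pi.smul_apply, smul_eq_mul,
      C_0, zero_mul, Finset.sum_const_zero, sub_eq_zero] at hrel0
    refine mul_right_cancel₀ (X_ne_zero (0 : Fin (n + 1))) ?_
    rw [← hrel0, ← pow_succ, Nat.sub_add_cancel (by omega)]
  rw [hH] at hrel'
  obtain ⟨h2, hform⟩ := hasPartialSkewForm_of_row_eq_zero hn (linearSubst_isHomogeneous hF g)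
    hA' hA0 fun i => congrFun hrel' i
  exact ⟨h2, g, hform⟩

end LinearSubst

/-! ### Degree and parity read off the normal forms -/

section Converse

variable {K : Type*} [Field K]

theorem IsNondegSkew.even {m : ℕ} {B : Matrix (Fin m) (Fin m) K} (hB : IsNondegSkew B) :
    Even m := by
  obtain ⟨h1, h2⟩ := isNondegSkew_iff.mp hB
  rw [← Nat.not_odd_iff_even]
  exact fun h => h2 (h1.det_eq_zero (by simpa using h))

theorem IsNondegSkew.exists_ne_zero {m : ℕ} (hm : 0 < m) {B : Matrix (Fin m) (Fin m) K}
    (hB : IsNondegSkew B) : ∃ i j, i ≠ j ∧ B i j ≠ 0 := by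
  by_contra! h
  have : B = 0 := by
    ext i j
    by_cases hij : i = j
    · rw [hij, hB.2.1]; rfl
    · exact h i j hij
  have : Nonempty (Fin m) := ⟨⟨0, hm⟩⟩
  exact hB.2.2 (by rw [‹B = 0›, Matrix.det_zero])

/-- The exponent of `x_i ^ q x_j`. -/
noncomputable def skewExponent {σ : Type*} (q : ℕ) (i j : σ) : σ →₀ ℕ :=
  Finsupp.single i q + Finsupp.single j 1

theorem skewExponent_eq_iff {σ : Type*} {q : ℕ} (hq : 2 ≤ q) {i j i' j' : σ} (hij : i ≠ j) :
    skewExponent q i' j' = skewExponent q i j ↔ i' = i ∧ j' = j := by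
  classical
  refine ⟨fun h => ?_, by rintro ⟨rfl, rfl⟩; rfl⟩
  have h1 := DFunLike.congr_fun h i
  have h2 := DFunLike.congr_fun h j
  simp only [skewExponent, Finsupp.add_apply, Finsupp.single_apply, hij, hij.symm, if_true,
    if_false] at h1 h2
  have hi : i' = i := by
    by_contra hne
    rw [if_neg hne] at h1
    split_ifs at h1 <;> omega
  subst hi
  refine ⟨rfl, ?_⟩
  by_contra hne
  rw [if_neg hij, if_neg hne] at h2
  omega

theorem coeff_skewForm {σ : Type*} {m q : ℕ} (hq : 2 ≤ q) (B : Matrix (Fin m) (Fin m) K)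
    {e : Fin m → σ} (he : Function.Injective e) {i j : Fin m} (hij : i ≠ j) :
    coeff (skewExponent q (e i) (e j)) (∑ i, ∑ j, X (e i) ^ q * C (B i j) * X (e j)) = B i j := by
  classical
  have hmon : ∀ i j, (X (e i) ^ q * C (B i j) * X (e j) : MvPolynomial σ K) =
      monomial (skewExponent q (e i) (e j)) (B i j) := by
    intro i j
    rw [X_pow_eq_monomial, mul_comm _ (C _), C_mul_monomial, X, monomial_mul, mul_one, mul_one]
    rfl
  simp only [hmon, coeff_sum, coeff_monomial, skewExponent_eq_iff hq (he.ne hij), he.eq_iff]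
  rw [Finset.sum_eq_single i (fun _ _ h => by simp [h]) (by simp),
    Finset.sum_eq_single j (fun _ _ h => by simp [h]) (by simp)]
  simp

theorem degree_skewExponent {σ : Type*} (q : ℕ) (i j : σ) :
    (skewExponent q i j).degree = q + 1 := by
  simp [skewExponent]

variable [Fintype K] {n d : ℕ} {F : MvPolynomial (Fin (n + 1)) K}

theorem HasSkewForm.degree_eq (hF : HasSkewForm F) (hd : F.IsHomogeneous d) :
    d = Fintype.card K + 1 ∧ Odd n := by
  have hq2 : 2 ≤ Fintype.card K := Fintype.one_lt_card
  obtain ⟨A, hA, rfl⟩ := hF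
  obtain ⟨i, j, hij, hAij⟩ := hA.exists_ne_zero n.succ_pos
  constructor
  · by_contra hne
    refine hAij ?_
    rw [← coeff_skewForm hq2 A Function.injective_id hij]
    exact hd.coeff_eq_zero (by rw [degree_skewExponent]; exact Ne.symm hne)
  · simpa [Nat.even_add_one] using hA.even

/-- The monomials x_i^q x_j with i, j ≥ 1 are untouched by the multiple of x_0, so a nonzero entry
of B fixes the degree. -/
theorem HasPartialSkewForm.degree_eq (hn : 2 ≤ n) (hF : HasPartialSkewForm F)
    (hd : F.IsHomogeneous d) : d = Fintype.card K + 1 ∧ Even n := by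
  have hq2 : 2 ≤ Fintype.card K := Fintype.one_lt_card
  obtain ⟨-, G, B, -, hB, hFG⟩ := hF
  obtain ⟨i, j, hij, hBij⟩ := hB.exists_ne_zero (by omega)
  refine ⟨?_, hB.even⟩
  by_contra hne
  refine hBij ?_
  have h1 : coeff (skewExponent (Fintype.card K) i.succ j.succ) F = 0 :=
    hd.coeff_eq_zero (by rw [degree_skewExponent]; exact Ne.symm hne)
  rwa [hFG, coeff_add, coeff_X_mul', if_neg (by simp [skewExponent]), zero_add,
    coeff_skewForm hq2 B (Fin.succ_injective n) hij] at h1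

theorem HasSkewForm.F10_eq_zero (hF : HasSkewForm F) : F10 F = 0 := by
  obtain ⟨A, hA, rfl⟩ := hF
  have hp : ∀ l, pderiv l (∑ i, ∑ j, X i ^ Fintype.card K * C (A i j) *
      (X j : MvPolynomial (Fin (n + 1)) K)) = ∑ i, X i ^ Fintype.card K * C (A i l) := by
    intro l
    simp only [map_sum, mul_assoc, pderiv_X_pow_card_mul, pderiv_C_mul, pderiv_X]
    simp [Pi.single_apply]
  have hquad := sum_mul_C_mul_self (isNondegSkew_iff.mp hA).1
    (fun i => (X i ^ Fintype.card K : MvPolynomial (Fin (n + 1)) K))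
  simp only [F10, hp]
  rw [← hquad]
  simp only [Finset.mul_sum]
  rw [Finset.sum_comm]
  exact Finset.sum_congr rfl fun _ _ => Finset.sum_congr rfl fun _ _ => by ring

end Converse

/-! ### Degrees prime to the characteristic -/

section Main

variable {K : Type*} [Field K] [Fintype K] {n d : ℕ} {F : MvPolynomial (Fin (n + 1)) K}

theorem IsFrobeniusNonclassical.exists_alternating (hn : 2 ≤ n) (hd : 2 ≤ d)
    (hF : F.IsHomogeneous d) (hs : IsSmooth F) (hFN : IsFrobeniusNonclassical F)
    (hdK : (d : K) ≠ 0) :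
    d ≤ Fintype.card K + 1 ∧ ∃ t : MvPolynomial (Fin (n + 1)) K, (F10 F = 0 → t = 0) ∧
      (d = Fintype.card K + 1 → ∃ A : Matrix (Fin (n + 1)) (Fin (n + 1)) K, IsAlternating A ∧
        ∀ i, X i ^ Fintype.card K - t * X i = ∑ j, C (A i j) * pderiv j F) := by
  have hq2 : 2 ≤ Fintype.card K := Fintype.one_lt_card
  obtain ⟨H, hHt, hH⟩ := hFN.exists_quotient (by omega) (by omega) hF hs
  have hEuler : ∑ i, X i * pderiv i F = C (d : K) * F := by
    rw [hF.sum_X_mul_pderiv, nsmul_eq_mul, map_natCast]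
  obtain ⟨h1, h2⟩ := hs.syzygy_pderiv (q := Fintype.card K) hd hF hdK
    (fun i => X i ^ Fintype.card K - H * C (d : K)⁻¹ * X i)
    (fun i => by
      rw [map_sub, truncDegree_of_isHomogeneous (isHomogeneous_X_pow i _) (Nat.lt_succ_self _),
        truncDegree_mul (isHomogeneous_X K i), Nat.add_sub_cancel,
        truncDegree_mul (isHomogeneous_C _ _), Nat.sub_zero, hHt])
    (by
      simp only [sub_mul, Finset.sum_sub_distrib, mul_assoc, ← Finset.mul_sum, hEuler]
      rw [← F10, hH, ← mul_assoc (C (d : K)⁻¹), ← C_mul, inv_mul_cancel₀ hdK, C_1, one_mul,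
        sub_self])
  refine ⟨?_, H * C (d : K)⁻¹, fun h => ?_, h2⟩
  · by_contra! hlt
    -- The syzygy vanishes, so x_i^q is the same multiple of x_i for every i, which fails for x_0
    -- and x_n.
    have h3 := h1 hlt
    have hlin : ∀ i : Fin (n + 1), linForm (Pi.single i (1 : K)) = X i := fun i => by
      simp [linForm, Pi.single_apply]
    have hpow : ∀ i : Fin (n + 1), powForm (Fintype.card K) (Pi.single i (1 : K)) =
        X i ^ Fintype.card K := fun i => by
      simp [powForm, Pi.single_apply]
    have h4 := linForm_mul_powForm_comm hq2 (c := Pi.single (0 : Fin (n + 1)) (1 : K))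
      (w := Pi.single (Fin.last n) (1 : K)) (by
        rw [hlin, hlin, hpow, hpow, sub_eq_zero.mp (h3 0), sub_eq_zero.mp (h3 (Fin.last n))]
        ring) 0 (Fin.last n)
    have h5 : Fin.last n ≠ 0 := fun h => by
      have := congrArg Fin.val h
      simp at this
      omega
    simp [h5, h5.symm] at h4
  · rw [h] at hH
    rw [(mul_eq_zero.mp hH.symm).resolve_right hs.ne_zero, zero_mul]

theorem eval_single_of_isHomogeneous {k σ : Type*} [Field k] [Fintype σ] [DecidableEq σ]
    {f : MvPolynomial σ k} {e : ℕ} (hf : f.IsHomogeneous e) (a : σ) :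
    eval (Pi.single a 1) f = coeff (Finsupp.single a e) f := by
  rw [eval_eq', Finset.sum_eq_single (Finsupp.single a e)]
  · rw [Finset.prod_eq_one, mul_one]
    intro x _
    by_cases hx : x = a
    · subst hx; simp
    · simp [Ne.symm hx]
  · intro m hm hne
    have hme : m.degree = e := by
      by_contra h
      exact mem_support_iff.mp hm (hf.coeff_eq_zero h)
    obtain ⟨x, hx, hmx⟩ : ∃ x, x ≠ a ∧ m x ≠ 0 := by
      by_contra! h
      have h1 : m = Finsupp.single a (m a) := by
        ext x
        by_cases hx : x = a
        · subst hx; simp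
        · simp [Ne.symm hx, h x hx]
      rw [h1] at hme
      simp only [Finsupp.degree_single] at hme
      rw [hme] at h1
      exact hne h1
    rw [Finset.prod_eq_zero (Finset.mem_univ x), mul_zero]
    simp [hx, hmx]
  · intro h
    simp [notMem_support_iff.mp h]

end Main

end FrobeniusNonclassical

/-! ### The classification -/

open FrobeniusNonclassical in
theorem theorem1p6 {K : Type*} [Field K] [Fintype K] (p : ℕ) [CharP K p] (q : ℕ)
    (hq : Fintype.card K = q) (n : ℕ) (hn : 2 ≤ n) (d : ℕ) (hd : 2 ≤ d)
    (F : MvPolynomial (Fin (n + 1)) K) (hF : F.IsHomogeneous d)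
    (hsmooth : FrobeniusNonclassical.IsSmooth F)
    (hFN : FrobeniusNonclassical.IsFrobeniusNonclassical F) :
    d ≤ q + 2 ∧
    ((d = q + 1 ∧ Odd n) ↔ FrobeniusNonclassical.HasSkewForm F) ∧
    ((d = q + 1 ∧ Even n) ↔
      (p = 2 ∧ ∃ g : Matrix.GeneralLinearGroup (Fin (n + 1)) K,
        FrobeniusNonclassical.HasPartialSkewForm (FrobeniusNonclassical.linearSubst g F))) ∧
    (d = q + 2 ↔
      (p = 2 ∧ ∃ h : n = 2, ∃ c : K, c ≠ 0 ∧
        FrobeniusNonclassical.HasTernaryForm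
          (C c * rename (Fin.cast (congrArg (· + 1) h)) F))) ∧
    (((d = q + 1 ∧ Odd n) ∨ d = q + 2) ↔ FrobeniusNonclassical.F10 F = 0) := by
  subst hq
  have hq2 : 2 ≤ Fintype.card K := Fintype.one_lt_card
  have hp : p.Prime := CharP.char_is_prime K p
  have hp2 : (2 : K) = 0 → p = 2 := fun h => by
    have : ((2 : ℕ) : K) = 0 := by exact_mod_cast h
    exact (Nat.prime_dvd_prime_iff_eq hp Nat.prime_two).mp ((CharP.cast_eq_zero_iff K p 2).mp this)
  have hcast1 : d = Fintype.card K + 1 → (d : K) ≠ 0 := by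
    rintro rfl
    simp
  have hle : d ≤ Fintype.card K + 2 := by
    by_cases hdK : (d : K) = 0
    · exact (hFN.degree_le hn hd hF hsmooth hdK).1
    · exact (hFN.exists_alternating hn hd hF hsmooth hdK).1.trans (Nat.le_succ _)
  have hcast2 : d = Fintype.card K + 2 → (d : K) = 0 := fun h => by
    by_contra hdK
    have := (hFN.exists_alternating hn hd hF hsmooth hdK).1
    omega
  have hskew : d = Fintype.card K + 1 → Odd n → HasSkewForm F := by
    intro h hodd
    obtain ⟨-, t, -, hA⟩ := hFN.exists_alternating hn hd hF hsmooth (hcast1 h)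
    obtain ⟨A, hA, hAt⟩ := hA h
    exact hasSkewForm_of_det_ne_zero (h ▸ hF) hA (det_ne_zero_of_odd hq2 hA hodd hAt) hAt
  refine ⟨hle, ⟨fun h => hskew h.1 h.2, fun h => h.degree_eq hF⟩, ⟨?_, ?_⟩, ⟨?_, ?_⟩, ⟨?_, ?_⟩⟩
  · rintro ⟨h, heven⟩
    obtain ⟨-, t, -, hA⟩ := hFN.exists_alternating hn hd hF hsmooth (hcast1 h)
    obtain ⟨A, hA, hAt⟩ := hA h
    obtain ⟨h2, hg⟩ := exists_hasPartialSkewForm hn (h ▸ hF) hA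
      (hA.det_eq_zero (by simpa using heven.add_one)) hAt
    exact ⟨hp2 h2, hg⟩
  · rintro ⟨-, g, hg⟩
    exact hg.degree_eq hn (linearSubst_isHomogeneous hF g)
  · intro h
    have hdK := hcast2 h
    obtain ⟨h10, rfl, hsupp⟩ := (hFN.degree_le hn hd hF hsmooth hdK).2 h
    have h2 : (2 : K) = 0 := by
      rw [h] at hdK
      simpa using hdK
    obtain rfl := hp2 h2
    -- The coefficient of x_a^(q+1) in F_i is its value at a rational point, hence 0.
    obtain ⟨c, hc, hform⟩ := exists_hasTernaryForm hsupp (fun i a => by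
      have h1 := eval_single_of_isHomogeneous (isHomogeneous_pderiv hF i) a
      rw [show d - 1 = Fintype.card K + 1 by omega] at h1
      rw [← h1]
      exact eval_pderiv_eq_zero hF hdK h10 i _) h10
      (hsmooth.exists_pderiv_ne_zero (by omega) (by omega) hF)
    refine ⟨rfl, rfl, c, hc, ?_⟩
    simpa using hform
  · rintro ⟨-, rfl, c, hc, hform⟩
    exact hform.degree_eq (hF.rename_isHomogeneous.C_mul c)
  · rintro (⟨h, hodd⟩ | h)
    · exact (hskew h hodd).F10_eq_zero
    · exact ((hFN.degree_le hn hd hF hsmooth (hcast2 h)).2 h).1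
  · intro h10
    by_cases hdK : (d : K) = 0
    · have := add_two_le_of_F10_eq_zero (by omega) (by omega) hsmooth hF hdK h10
      exact Or.inr (by omega)
    · left
      have h1 := card_lt_of_F10_eq_zero hsmooth hF hdK h10
      obtain ⟨h2, t, ht, hA⟩ := hFN.exists_alternating hn hd hF hsmooth hdK
      have h3 : d = Fintype.card K + 1 := by omega
      obtain ⟨A, hA, hAt⟩ := hA h3
      rw [ht h10] at hAt
      refine ⟨h3, ?_⟩
      rw [← Nat.not_even_iff_odd]
      intro heven
      -- With `t = 0` a kernel vector would give ∑ v_i x_i^q = 0.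
      obtain ⟨v, hv0, hv⟩ := Matrix.exists_vecMul_eq_zero_iff.mpr
        (hA.det_eq_zero (by simpa using heven.add_one))
      have h4 := powForm_eq_of_vecMul hAt hv
      refine hv0 (funext fun i => ?_)
      have h5 := congrArg (eval (Pi.single i 1)) h4
      simpa [powForm, Pi.single_apply, ite_pow, show Fintype.card K ≠ 0 by omega] using h5
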